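/- Let $(X,\sigma)$ be a surjective multivariable dynamical system: $X$ is a locally compact Hausdorff space, $\sigma=(\sigma_1,\dots,\sigma_n)$ are proper continuous maps $X\to X$, and $X=\bigcup_{i=1}^n\sigma_i(X)$. Let $\tilde X=\{(\mathbf i,\mathbf x)\in\{1,\dots,n\}^{\mathbb N}\times X^{\mathbb N} : \sigma_{i_k}(x_{k+1})=x_k \text{ for all } k\ge 0\}$ with the relative product topology. Define $\tilde\sigma_i(\mathbf i,\mathbf x)=\big((i,i_0,i_1,\dots),(\sigma_i(x_0),x_0,x_1,\dots)\big)$ and $\tau(\mathbf i,\mathbf x)=\big((i_1,i_2,\dots),(x_1,x_2,\dots)\big)$, so that $\tau$ restricted to $\tilde\sigma_i(\tilde X)$ is $\tilde\sigma_i^{-1}$. For a word $w=i_1\cdots i_k$ in $\{1,\dots,n\}$ write $|w|=k$ and $\tilde\sigma_w=\tilde\sigma_{i_1}\circ\cdots\circ\tilde\sigma_{i_k}$. A subset $F\subseteq\tilde X$ is \emph{$\tau$-invariant} if $\tau(F)\subseteq F$, and \emph{robust} if $\tilde\sigma_w\tau^{|w|}(x)\in F$ for every $x\in F$ and every word $w$.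 For closed $F$ put $I_F=\{f\in \mathrm C_0(\tilde X): f|_F=0\}$. Let $\mathcal A(\tilde X,\tilde\sigma)$ be the tensor algebra of the system $(\tilde X,\tilde\sigma)$: the completion of the algebra of finite sums $\sum_w\mathfrak t_w f_w$ with $f_w\in \mathrm C_0(\tilde X)$, $\mathfrak t_w=\mathfrak t_{i_1}\cdots\mathfrak t_{i_k}$ and the relations $f\,\mathfrak t_i=\mathfrak t_i\,(f\circ\tilde\sigma_i)$, in the operator algebra (matrix) norms given by the supremum over all representations on Hilbert space that restrict to a $*$-representation of $\mathrm C_0(\tilde X)$ and make $[\mathfrak t_1\ \cdots\ \mathfrak t_n]$ a row contraction. Let $\mathfrak A$ be the C*-envelope of $\mathcal A(\tilde X,\tilde\sigma)$ (which is also the C*-envelope of $\mathcal A(X,\sigma)$): the C*-algebra generated by a completely isometric representation of it that is a quotient, compatibly with the representations, of the C*-algebra generated by any other completely isometric representation. In $\mathfrak A$ let \[ \mathfrak B=\overline{\operatorname{span}}\{\mathfrak t_u f\mathfrak t_v^* : |u|=|v|,\ f\in \mathrm C_0(\tilde X)\},\qquad \alpha(b)=\frac1n\sum_{i,j=1}^n\mathfrak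 t_i\,b\,\mathfrak t_j^*\quad(b\in\mathfrak B). \] Then the $\alpha$-invariant ideals of $\mathfrak B$ (closed two-sided ideals $\mathfrak J$ with $\alpha(\mathfrak J)\subseteq\mathfrak J$) are in bijective correspondence with the closed, robust, $\tau$-invariant subsets of $\tilde X$, via the map that sends $\mathfrak J$ to the unique closed set $F\subseteq\tilde X$ with $\mathfrak J\cap \mathrm C_0(\tilde X)=I_F$. -/

import Mathlib

open scoped ZeroAtInfty

universe u

noncomputable section

/-- A multivariable dynamical system: a tuple of `n` proper continuous self-maps of `X`.
(`IsProperMap` includes continuity.) -/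
structure MultiSystem (n : ℕ) (X : Type u) [TopologicalSpace X] where
  map : Fin n → X → X
  isProper : ∀ i, IsProperMap (map i)

namespace MultiSystem

variable {n : ℕ} {X : Type u} [TopologicalSpace X]

/-- The system is surjective: `X = ⋃ i, σ_i(X)`. -/
def IsSurjective (S : MultiSystem n X) : Prop :=
  (⋃ i, Set.range (S.map i)) = Set.univ

/-- `σ_w = σ_{i₁} ∘ ⋯ ∘ σ_{i_k}` for the word `w = i₁ ⋯ i_k`. -/
def wordMap (S : MultiSystem n X) (w : List (Fin n)) (x : X) : X :=
  w.foldr S.map x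

theorem tendsto_cocompact (S : MultiSystem n X) (i : Fin n) :
    Filter.Tendsto (S.map i) (Filter.cocompact X) (Filter.cocompact X) := by
  intro s hs
  obtain ⟨K, hK, hKs⟩ := Filter.mem_cocompact.1 hs
  refine Filter.mem_cocompact.2 ⟨S.map i ⁻¹' K, (S.isProper i).isCompact_preimage hK, ?_⟩
  intro x hx
  exact hKs hx

/-- `f ∘ σ_i` as an element of `C₀(X)`. -/
def pullback (S : MultiSystem n X) (i : Fin n) (f : C₀(X, ℂ)) : C₀(X, ℂ) :=
  f.comp { toFun := S.map i
           continuous_toFun := (S.isProper i).continuous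
           cocompact_tendsto' := S.tendsto_cocompact i }

/-! ### The covering system -/

/-- The space of infinite tails `(𝐢, 𝐱)` with `σ_{i_k}(x_{k+1}) = x_k`, with the topology induced
by the product topology (`Fin n` being discrete). -/
abbrev Tail (S : MultiSystem n X) : Type u :=
  {z : (ℕ → Fin n) × (ℕ → X) // ∀ k, S.map (z.1 k) (z.2 (k + 1)) = z.2 k}

/-- `(a, s₀, s₁, …)`. -/
def consSeq {α : Type*} (a : α) (s : ℕ → α) : ℕ → α
  | 0 => a
  | k + 1 => s k

/-- `σ̃_i (𝐢, 𝐱) = ((i, i₀, i₁, …), (σ_i(x₀), x₀, x₁, …))`. -/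
def tailMap (S : MultiSystem n X) (i : Fin n) (z : S.Tail) : S.Tail :=
  ⟨(consSeq i z.1.1, consSeq (S.map i (z.1.2 0)) z.1.2), by
    intro k
    cases k with
    | zero => rfl
    | succ k => exact z.2 k⟩

/-- `τ (𝐢, 𝐱) = ((i₁, i₂, …), (x₁, x₂, …))`; by the next two lemmas this is the map that restricts
to the inverse of `σ̃_i` on each `X̃_i = {(𝐢, 𝐱) | i₀ = i}`. -/
def shift (S : MultiSystem n X) (z : S.Tail) : S.Tail :=
  ⟨(fun k => z.1.1 (k + 1), fun k => z.1.2 (k + 1)), fun k => z.2 (k + 1)⟩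

theorem shift_tailMap (S : MultiSystem n X) (i : Fin n) (z : S.Tail) :
    S.shift (S.tailMap i z) = z := rfl

theorem tailMap_shift (S : MultiSystem n X) (z : S.Tail) :
    S.tailMap (z.1.1 0) (S.shift z) = z := by
  apply Subtype.ext
  refine Prod.ext ?_ ?_
  · funext k
    cases k <;> rfl
  · funext k
    cases k with
    | zero => exact z.2 0
    | succ k => rfl

theorem continuous_shift (S : MultiSystem n X) : Continuous S.shift := by
  unfold shift
  fun_prop

theorem continuous_tailMap (S : MultiSystem n X) (i : Fin n) : Continuous (S.tailMap i) := by
  refine Continuous.subtype_mk (Continuous.prodMk ?_ ?_) _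
  · refine continuous_pi fun k => ?_
    cases k with
    | zero => exact continuous_const
    | succ k =>
      change Continuous fun z : S.Tail => z.1.1 k
      fun_prop
  · refine continuous_pi fun k => ?_
    cases k with
    | zero =>
      change Continuous fun z : S.Tail => S.map i (z.1.2 0)
      exact (S.isProper i).continuous.comp (by fun_prop)
    | succ k =>
      change Continuous fun z : S.Tail => z.1.2 k
      fun_prop

/-- The covering system `(X̃, σ̃)`. -/
def cover [T2Space X] (S : MultiSystem n X) : MultiSystem n S.Tail where
  map := S.tailMap
  isProper i :=
    (Function.LeftInverse.isClosedEmbedding (S.shift_tailMap i) S.continuous_shift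
      (S.continuous_tailMap i)).isProperMap

/-- `F` is robust: it contains `σ̃_w τ^{|w|}(x)` for every `x ∈ F` and every word `w`. -/
def IsRobust [T2Space X] (S : MultiSystem n X) (F : Set S.Tail) : Prop :=
  ∀ x ∈ F, ∀ w : List (Fin n), S.cover.wordMap w (S.shift^[w.length] x) ∈ F

/-- `F` is `τ`-invariant: `τ(F) ⊆ F`. -/
def IsShiftInvariant (S : MultiSystem n X) (F : Set S.Tail) : Prop :=
  ∀ x ∈ F, S.shift x ∈ F

/-! ### The tensor algebra and its C*-envelope -/

/-- Elements `∑ 𝔰_w f_w` (finite sums) of the covariance algebra `𝒜₀(X, σ)`. -/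
abbrev CovAlg (_S : MultiSystem n X) : Type u := List (Fin n) →₀ C₀(X, ℂ)

end MultiSystem

/-- The operator on the Hilbert space `H^m` given by an `m × m` matrix of operators on `H`;
its norm is the norm of the matrix in `𝔐_m(ℬ(H))`. -/
def blockOp {H : Type*} [NormedAddCommGroup H] [InnerProductSpace ℂ H] {m : ℕ}
    (M : Matrix (Fin m) (Fin m) (H →L[ℂ] H)) :
    PiLp 2 (fun _ : Fin m => H) →L[ℂ] PiLp 2 (fun _ : Fin m => H) :=
  (PiLp.continuousLinearEquiv 2 ℂ (fun _ : Fin m => H)).symm.toContinuousLinearMap ∘L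
    (ContinuousLinearMap.pi fun i => ∑ j, M i j ∘L ContinuousLinearMap.proj j) ∘L
    (PiLp.continuousLinearEquiv 2 ℂ (fun _ : Fin m => H)).toContinuousLinearMap

/-- A row contractive representation of the covariance algebra of `(X, σ)` on a Hilbert space:
a `*`-representation `π` of `C₀(X)` and operators `T i = ρ(𝔰_i)` satisfying the covariance relations
`f 𝔰_i = 𝔰_i (f ∘ σ_i)` and `‖[T₁ ⋯ T_n]‖ ≤ 1`.  -/
structure RowRep {n : ℕ} {X : Type u} [TopologicalSpace X] (S : MultiSystem n X)
    (H : Type u) [NormedAddCommGroup H] [InnerProductSpace ℂ H] [CompleteSpace H] where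
  π : C₀(X, ℂ) →⋆ₙₐ[ℂ] (H →L[ℂ] H)
  T : Fin n → (H →L[ℂ] H)
  covariant : ∀ i f, π f * T i = T i * π (S.pullback i f)
  row_contractive : ∀ h : Fin n → H, ‖∑ i, T i (h i)‖ ^ 2 ≤ ∑ i, ‖h i‖ ^ 2

namespace RowRep

variable {n : ℕ} {X : Type u} [TopologicalSpace X] {S : MultiSystem n X}
  {H : Type u} [NormedAddCommGroup H] [InnerProductSpace ℂ H] [CompleteSpace H]

/-- `ρ(𝔰_w) = ρ(𝔰_{i₁}) ⋯ ρ(𝔰_{i_k})` for `w = i₁ ⋯ i_k`. -/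
def word (ρ : RowRep S H) (w : List (Fin n)) : H →L[ℂ] H := (w.map ρ.T).prod

/-- `ρ(∑ 𝔰_w f_w) = ∑ ρ(𝔰_w) ρ(f_w)`. -/
def eval (ρ : RowRep S H) (a : S.CovAlg) : H →L[ℂ] H :=
  a.sum fun w f => ρ.word w * ρ.π f

/-- The image under `ρ` of a matrix over the covariance algebra. -/
def evalMatrix (ρ : RowRep S H) {m : ℕ} (a : Matrix (Fin m) (Fin m) S.CovAlg) :
    PiLp 2 (fun _ : Fin m => H) →L[ℂ] PiLp 2 (fun _ : Fin m => H) :=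
  blockOp fun i j => ρ.eval (a i j)

end RowRep

/-- The norm on `𝔐_m` of the tensor algebra `𝒜(X, σ)`, on matrices over the dense subalgebra
`𝒜₀(X, σ)`: the supremum over all row contractive representations. -/
def MultiSystem.tensorNorm {n : ℕ} {X : Type u} [TopologicalSpace X] (S : MultiSystem n X) {m : ℕ}
    (a : Matrix (Fin m) (Fin m) S.CovAlg) : ℝ :=
  sSup {r | ∃ (H : Type u) (_ : NormedAddCommGroup H) (_ : InnerProductSpace ℂ H)
    (_ : CompleteSpace H) (ρ : RowRep S H), r = ‖ρ.evalMatrix a‖}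

namespace RowRep

variable {n : ℕ} {X : Type u} [TopologicalSpace X] {S : MultiSystem n X}
  {H : Type u} [NormedAddCommGroup H] [InnerProductSpace ℂ H] [CompleteSpace H]

/-- `ρ` is a completely isometric representation of the tensor algebra. -/
def IsCompletelyIsometric (ρ : RowRep S H) : Prop :=
  ∀ (m : ℕ) (a : Matrix (Fin m) (Fin m) S.CovAlg), ‖ρ.evalMatrix a‖ = S.tensorNorm a

/-- The C*-algebra `C*(ρ(𝒜(X, σ)))`, i.e. the norm closed `*`-subalgebra generated by the range. -/
def cstar (ρ : RowRep S H) : NonUnitalStarSubalgebra ℂ (H →L[ℂ] H) :=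
  (NonUnitalStarAlgebra.adjoin ℂ (Set.range ρ.eval)).topologicalClosure

theorem eval_mem_cstar (ρ : RowRep S H) (a : S.CovAlg) : ρ.eval a ∈ ρ.cstar :=
  NonUnitalStarSubalgebra.le_topologicalClosure _
    (NonUnitalStarAlgebra.subset_adjoin ℂ _ (Set.mem_range_self a))

/-- `ρ.cstar` (with `ρ`) is the C*-envelope of the tensor algebra: `ρ` is completely isometric, and
for every completely isometric representation `ρ'` there is a surjective `*`-homomorphism
`q : C*(ρ'(𝒜)) → C*(ρ(𝒜))` with `q ρ' = ρ`. -/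
def IsCStarEnvelope (ρ : RowRep S H) : Prop :=
  ρ.IsCompletelyIsometric ∧
  ∀ (K : Type u) [NormedAddCommGroup K] [InnerProductSpace ℂ K] [CompleteSpace K]
    (ρ' : RowRep S K), ρ'.IsCompletelyIsometric →
    ∃ q : ρ'.cstar →⋆ₙₐ[ℂ] ρ.cstar, Function.Surjective q ∧
      ∀ a : S.CovAlg, q ⟨ρ'.eval a, ρ'.eval_mem_cstar a⟩ = ⟨ρ.eval a, ρ.eval_mem_cstar a⟩

/-! ### The algebra `𝔅`, the endomorphism `α` and ideals -/

/-- `𝔅`, the closed span of the elements `𝔱_u f 𝔱_v^*` with `|u| = |v|`. -/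
def coreAlg (ρ : RowRep S H) : Submodule ℂ (H →L[ℂ] H) :=
  (Submodule.span ℂ {b | ∃ (u v : List (Fin n)) (f : C₀(X, ℂ)), u.length = v.length ∧
    b = ρ.word u * ρ.π f * star (ρ.word v)}).topologicalClosure

/-- `α(b) = (1/n) ∑_{i,j} 𝔱_i b 𝔱_j^*`. -/
def endo (ρ : RowRep S H) (b : H →L[ℂ] H) : H →L[ℂ] H :=
  (n : ℂ)⁻¹ • ∑ i, ∑ j, ρ.T i * b * star (ρ.T j)

/-- `J` is an `α`-invariant (closed, two-sided) ideal of `𝔅`. -/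
structure IsInvariantIdeal (ρ : RowRep S H) (J : Submodule ℂ (H →L[ℂ] H)) : Prop where
  le : J ≤ ρ.coreAlg
  isClosed : IsClosed (J : Set (H →L[ℂ] H))
  mul_mem_left : ∀ b ∈ ρ.coreAlg, ∀ x ∈ J, b * x ∈ J
  mul_mem_right : ∀ b ∈ ρ.coreAlg, ∀ x ∈ J, x * b ∈ J
  endo_mem : ∀ x ∈ J, ρ.endo x ∈ J

/-- `J ∩ C₀(X)`, where `C₀(X)` sits in `𝔅` via `π`. -/
def interFun (ρ : RowRep S H) (J : Submodule ℂ (H →L[ℂ] H)) : Set C₀(X, ℂ) :=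
  {f | ρ.π f ∈ J}

end RowRep

/-- `I_F = {f ∈ C₀(Y) : f|F = 0}`. -/
def vanishingIdeal {Y : Type u} [TopologicalSpace Y] (F : Set Y) : Set C₀(Y, ℂ) :=
  {f | ∀ x ∈ F, f x = 0}

end

noncomputable section

/-! Only three facts about the envelope matter, collected in `IsCuntz`: the t_i are isometries with
orthogonal ranges, their range projections sum to 1 (both relative to C₀(X̃)), and C₀(X̃) embeds
isometrically. The relations hold in the regular representation on ℓ²(X̃ × ℤ), because the maps σ̃_i
are injective and their ranges partition X̃. They descend to the envelope because that
representation is completely isometric: a Poisson kernel argument compresses r^{|w|} t_w, for r < 1,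
from Fock space, where the entries of an element are C₀ functions whose pointwise matrices are
compressions of the regular representation (`norm_evalMatrix_le_regularRep`,
`IsCStarEnvelope.isCuntz`).

Given the relations, the t_u f t_v^* with |u| = |v| = k behave like matrices over C₀(X̃), and f = ∑
t_i (f ∘ σ̃_i) t_i^* makes these levels increase to a dense subspace of 𝔅. Moreover t_u f t_u^* lies
in C₀(X̃): it is f transported to the range of σ̃_u.

To F corresponds the closed union of the matrices over I_{τ^k(F)} (`idealOf`). Robustness makes
these levels increase, which gives an ideal; τ-invariance gives invariance under α; a diagonal
compression shows that the ideal meets C₀(X̃) in I_F.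

Conversely let F be the zero set of J ∩ C₀(X̃). Compressing elements of J and of α(J) by matrix
units shows that F is robust and τ-invariant, and `idealOf F` ≤ J follows from the diagonal
elements. For the other inclusion, approximate j ∈ J by a matrix of functions b at level k. Since
C₀(X̃)/I_F embeds isometrically in 𝔅/J, the matrix b(y) has norm at most ‖b - j‖ for y ∈ τ^k(F)
(`IsInvariantIdeal.norm_matrix_le`). A scalar cutoff then moves b slightly into `idealOf F`. -/

theorem c0_sum_apply {ι Y : Type*} [TopologicalSpace Y] (t : Finset ι) (F : ι → C₀(Y, ℂ)) (y : Y) :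
    (∑ s ∈ t, F s) y = ∑ s ∈ t, F s y := by
  classical
  induction t using Finset.induction_on with
  | empty => simp
  | insert a t ha ih => simp [Finset.sum_insert ha, ih]

/-! ### Operator matrices -/

section OperatorMatrix

variable {ι : Type*} [Fintype ι] {H : Type*} [NormedAddCommGroup H] [InnerProductSpace ℂ H]

/-- The operator on `H^ι` given by a square matrix of operators on `H`. -/
def matOp (M : ι → ι → H →L[ℂ] H) :
    PiLp 2 (fun _ : ι => H) →L[ℂ] PiLp 2 (fun _ : ι => H) :=
  (PiLp.continuousLinearEquiv 2 ℂ (fun _ : ι => H)).symm.toContinuousLinearMap ∘L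
    (ContinuousLinearMap.pi fun i => ∑ j, M i j ∘L ContinuousLinearMap.proj j) ∘L
    (PiLp.continuousLinearEquiv 2 ℂ (fun _ : ι => H)).toContinuousLinearMap

theorem matOp_apply (M : ι → ι → H →L[ℂ] H) (x : PiLp 2 (fun _ : ι => H)) (p : ι) :
    matOp M x p = ∑ q, M p q (x q) := by
  simp [matOp]

theorem inner_matOp (M : ι → ι → H →L[ℂ] H) (x y : PiLp 2 (fun _ : ι => H)) :
    inner ℂ y (matOp M x) = ∑ p, ∑ q, inner ℂ (y p) (M p q (x q)) := by
  simp [PiLp.inner_apply, matOp_apply, inner_sum]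

theorem norm_toLp_two {ι H : Type*} [Fintype ι] [NormedAddCommGroup H] (x : ι → H) :
    ‖WithLp.toLp 2 x‖ = √(∑ q, ‖x q‖ ^ 2) := by
  rw [PiLp.norm_eq_of_L2]

variable [CompleteSpace H]

open scoped Matrix.Norms.L2Operator

variable [DecidableEq ι] {Y : Type*} [TopologicalSpace Y]

/-- Makes C₀(Y, M_ι) a C*-algebra, so that `*`-homomorphisms out of it are automatically
contractive. -/
instance : NonUnitalCStarAlgebra (Matrix ι ι ℂ) where

/-- An entry of a matrix valued `C₀` function. -/
def c0Entry (G : C₀(Y, Matrix ι ι ℂ)) (p q : ι) : C₀(Y, ℂ) where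
  toFun y := G y p q
  continuous_toFun := (map_continuous G).matrix_elem p q
  zero_at_infty' := by
    have h : Continuous fun A : Matrix ι ι ℂ => A p q := continuous_id.matrix_elem p q
    exact (h.tendsto 0).comp (zero_at_infty G)

theorem c0Entry_apply {ι : Type*} [Fintype ι] [DecidableEq ι] (G : C₀(Y, Matrix ι ι ℂ)) (p q : ι)
    (y : Y) : c0Entry G p q y = G y p q := rfl

/-- The representation of `C₀(Y, M_ι)` on `H^ι` induced by a representation of `C₀(Y)` on `H`. -/
def amplify (π : C₀(Y, ℂ) →⋆ₙₐ[ℂ] (H →L[ℂ] H)) : C₀(Y, Matrix ι ι ℂ) →⋆ₙₐ[ℂ]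
    (PiLp 2 (fun _ : ι => H) →L[ℂ] PiLp 2 (fun _ : ι => H)) where
  toFun G := matOp fun p q => π (c0Entry G p q)
  map_smul' c G := by
    ext x p
    have h : ∀ p q, c0Entry (c • G) p q = c • c0Entry G p q := fun p q => by
      ext y; simp [c0Entry_apply]
    simp [matOp_apply, h, Finset.smul_sum]
  map_zero' := by
    ext x p
    have h : ∀ p q, c0Entry (0 : C₀(Y, Matrix ι ι ℂ)) p q = 0 := fun p q => by
      ext y; simp [c0Entry_apply]
    simp [matOp_apply, h]
  map_add' G G' := by
    ext x p
    have h : ∀ p q, c0Entry (G + G') p q = c0Entry G p q + c0Entry G' p q := fun p q => by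
      ext y; simp [c0Entry_apply]
    simp [matOp_apply, h, Finset.sum_add_distrib]
  map_mul' G G' := by
    ext x p
    have h : ∀ p q, c0Entry (G * G') p q = ∑ s, c0Entry G p s * c0Entry G' s q := fun p q => by
      ext y
      simp [c0Entry_apply, c0_sum_apply, Matrix.mul_apply]
    simp only [matOp_apply, h, map_sum, map_mul, mul_apply_eq_comp,
      sum_apply]
    rw [Finset.sum_comm]
  map_star' G := by
    refine ContinuousLinearMap.ext fun x => ext_inner_left ℂ fun y => ?_
    have h : ∀ p q, c0Entry (star G) p q = star (c0Entry G q p) := fun p q => by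
      ext y; simp [c0Entry_apply, Matrix.star_apply]
    rw [ContinuousLinearMap.star_eq_adjoint, ContinuousLinearMap.adjoint_inner_right, inner_matOp,
      ← inner_conj_symm, inner_matOp]
    simp only [h, map_star, map_sum, inner_conj_symm, ContinuousLinearMap.star_eq_adjoint,
      ContinuousLinearMap.adjoint_inner_right]
    rw [Finset.sum_comm]

/-- The amplification is a `*`-homomorphism, hence contractive for the supremum over y of the matrix
norms. This is how pointwise matrix bounds become operator bounds. -/
theorem norm_sum_inner_le_of_matrix_norm_le (π : C₀(Y, ℂ) →⋆ₙₐ[ℂ] (H →L[ℂ] H))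
    (g : ι → ι → C₀(Y, ℂ)) {c : ℝ} (hc : 0 ≤ c)
    (hg : ∀ y, ‖(Matrix.of fun p q => g p q y : Matrix ι ι ℂ)‖ ≤ c) (x z : ι → H) :
    ‖∑ p, ∑ q, inner ℂ (z p) (π (g p q) (x q))‖ ≤
      c * √(∑ q, ‖x q‖ ^ 2) * √(∑ p, ‖z p‖ ^ 2) := by
  let G : C₀(Y, Matrix ι ι ℂ) :=
    { toFun := fun y => Matrix.of fun p q => g p q y
      continuous_toFun := continuous_matrix fun p q => map_continuous (g p q)
      zero_at_infty' := by
        refine tendsto_pi_nhds.2 fun p => tendsto_pi_nhds.2 fun q => ?_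
        exact zero_at_infty (g p q) }
  have hG : ‖G‖ ≤ c := by
    rw [← ZeroAtInftyContinuousMap.norm_toBCF_eq_norm]
    exact (BoundedContinuousFunction.norm_le hc).2 hg
  have h1 : ‖amplify π G‖ ≤ c := (NonUnitalStarAlgHom.norm_apply_le (amplify π) G).trans hG
  have h2 := inner_matOp (fun p q => π (g p q)) (WithLp.toLp 2 x) (WithLp.toLp 2 z)
  have h3 : amplify π G = matOp fun p q => π (g p q) := rfl
  simp only at h2
  rw [← h2, ← h3, ← norm_toLp_two, ← norm_toLp_two]
  calc _ ≤ ‖WithLp.toLp 2 z‖ * ‖amplify π G (WithLp.toLp 2 x)‖ := norm_inner_le_norm _ _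
    _ ≤ ‖WithLp.toLp 2 z‖ * (c * ‖WithLp.toLp 2 x‖) := by
      gcongr
      exact (amplify π G).le_of_opNorm_le h1 _
    _ = _ := by ring

end OperatorMatrix

end

noncomputable section

/-! ### Functions vanishing at infinity -/

section C0

variable {Y : Type u} [TopologicalSpace Y]

/-- The product of a `C₀` function and a bounded continuous function. -/
def c0MulBounded (f : C₀(Y, ℂ)) (φ : Y → ℂ) (hφ : Continuous φ) (c : ℝ) (hc : ∀ y, ‖φ y‖ ≤ c) :
    C₀(Y, ℂ) where
  toFun y := f y * φ y
  continuous_toFun := (map_continuous f).mul hφ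
  zero_at_infty' := by
    refine squeeze_zero_norm (a := fun y => ‖f y‖ * c) (fun y => ?_) ?_
    · rw [norm_mul]
      gcongr
      exact hc y
    · simpa using (zero_at_infty f).norm.mul_const c

theorem c0MulBounded_apply (f : C₀(Y, ℂ)) (φ : Y → ℂ) (hφ : Continuous φ) (c : ℝ)
    (hc : ∀ y, ‖φ y‖ ≤ c) (y : Y) : c0MulBounded f φ hφ c hc y = f y * φ y := rfl

theorem c0_norm_le (f : C₀(Y, ℂ)) {c : ℝ} (hc : 0 ≤ c) : ‖f‖ ≤ c ↔ ∀ y, ‖f y‖ ≤ c := by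
  rw [← ZeroAtInftyContinuousMap.norm_toBCF_eq_norm]
  exact BoundedContinuousFunction.norm_le hc

theorem c0_norm_apply_le (f : C₀(Y, ℂ)) (y : Y) : ‖f y‖ ≤ ‖f‖ :=
  (c0_norm_le f (norm_nonneg f)).1 le_rfl y

theorem exists_isCompact_norm_lt (f : C₀(Y, ℂ)) {ε : ℝ} (hε : 0 < ε) :
    ∃ K, IsCompact K ∧ ∀ y ∉ K, ‖f y‖ < ε := by
  have h : ∀ᶠ y in Filter.cocompact Y, ‖f y‖ < ε := by
    have := (zero_at_infty f).norm
    rw [norm_zero] at this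
    exact this.eventually_lt_const hε
  obtain ⟨K, hK, hKs⟩ := Filter.mem_cocompact.1 h
  exact ⟨K, hK, fun y hy => hKs hy⟩

/-- A closed ideal of `C₀(Y)` consists of the functions vanishing on its zero set. -/
theorem closed_ideal_eq_vanishingIdeal (I : Submodule ℂ C₀(Y, ℂ))
    (hI : ∀ g, ∀ f ∈ I, g * f ∈ I) (hcl : IsClosed (I : Set C₀(Y, ℂ))) :
    (I : Set C₀(Y, ℂ)) = vanishingIdeal {y | ∀ f ∈ I, f y = 0} := by
  refine Set.Subset.antisymm (fun f hf y hy => hy f hf) fun f hf => ?_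
  rw [← hcl.closure_eq]
  refine Metric.mem_closure_iff.2 fun ε hε => ?_
  obtain ⟨K, hK, hKf⟩ := exists_isCompact_norm_lt f (half_pos hε)
  -- Off this compact set f is already small. On it finitely many elements of the ideal have no
  -- common zero, so G = ∑ |g_y|² is an element of the ideal bounded below there.
  let K' : Set Y := K ∩ {y | ε / 2 ≤ ‖f y‖}
  have hK' : IsCompact K' :=
    hK.inter_right (isClosed_le continuous_const (map_continuous f).norm)
  have hex : ∀ y ∈ K', ∃ g ∈ I, g y ≠ 0 := by
    intro y hy
    by_contra! hcon
    have := hf y hcon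
    have h2 := hy.2
    simp only [Set.mem_ofPred_eq, this, norm_zero] at h2
    linarith
  choose! g hgI hg using hex
  obtain ⟨t, htK, ht⟩ := hK'.elim_nhds_subcover (fun y => {z | g y z ≠ 0}) fun y hy =>
    (isOpen_ne_fun (map_continuous (g y)) continuous_const).mem_nhds (hg y hy)
  let G : C₀(Y, ℂ) := ∑ y ∈ t, star (g y) * g y
  have hGI : G ∈ I := I.sum_mem fun y hy => hI _ _ (hgI y (htK y hy))
  let s : Y → ℝ := fun z => ∑ y ∈ t, ‖g y z‖ ^ 2
  have hs : Continuous s := continuous_finsetSum _ fun y _ => (map_continuous (g y)).norm.pow 2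
  have hGs : ∀ z, G z = (s z : ℂ) := by
    intro z
    simp only [G, s, c0_sum_apply, Complex.ofReal_sum]
    refine Finset.sum_congr rfl fun y _ => ?_
    rw [ZeroAtInftyContinuousMap.mul_apply, ZeroAtInftyContinuousMap.star_apply,
      Complex.star_def, Complex.conj_mul']
    simp
  have hs0 : ∀ z, 0 ≤ s z := fun z => Finset.sum_nonneg fun y _ => by positivity
  have hspos : ∀ z ∈ K', 0 < s z := by
    intro z hz
    obtain ⟨y, hy, hyz⟩ := Set.mem_iUnion₂.1 (ht hz)
    have hyz' : g y z ≠ 0 := hyz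
    exact Finset.sum_pos' (fun y _ => by positivity) ⟨y, hy, by positivity⟩
  obtain ⟨δ, hδ, hδs⟩ := hK'.exists_forall_le' hs.continuousOn hspos
  -- The approximant is f · mG / (1 + mG), with error f / (1 + mG); this m makes the error at most ε
  -- / 2 where G ≥ δ.
  obtain ⟨m, hm⟩ := exists_nat_gt (2 * ‖f‖ / (ε * δ))
  have hden : ∀ z, (0 : ℝ) < 1 + m * s z := fun z => by have := hs0 z; positivity
  let φ : Y → ℂ := fun z => ((m / (1 + m * s z) : ℝ) : ℂ)
  have hφ : Continuous φ := Complex.continuous_ofReal.comp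
    (continuous_const.div (by fun_prop) fun z => (hden z).ne')
  have hφm : ∀ z, ‖φ z‖ ≤ m := by
    intro z
    rw [Complex.norm_real, Real.norm_of_nonneg (div_nonneg (Nat.cast_nonneg m) (hden z).le)]
    refine div_le_self (Nat.cast_nonneg m) ?_
    have := hs0 z
    have : 0 ≤ m * s z := by positivity
    linarith
  refine ⟨c0MulBounded f φ hφ m hφm * G, hI _ _ hGI, ?_⟩
  rw [dist_eq_norm]
  refine lt_of_le_of_lt ((c0_norm_le _ (half_pos hε).le).2 fun z => ?_) (half_lt_self hε)
  have hval : (f - c0MulBounded f φ hφ m hφm * G) z = f z * ((1 / (1 + m * s z) : ℝ) : ℂ) := by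
    rw [ZeroAtInftyContinuousMap.sub_apply, ZeroAtInftyContinuousMap.mul_apply,
      c0MulBounded_apply, hGs]
    have h : (1 / (1 + m * s z) : ℝ) = 1 - m / (1 + m * s z) * s z := by
      have := (hden z).ne'
      field_simp
      ring
    rw [h]
    simp only [φ]
    push_cast
    ring
  rw [hval, norm_mul, Complex.norm_real, Real.norm_of_nonneg (div_nonneg zero_le_one (hden z).le)]
  by_cases hz : z ∈ K'
  · have h1 : 2 * ‖f‖ < m * (ε * δ) := (div_lt_iff₀ (by positivity)).1 hm
    have h2 : m * δ ≤ m * s z := by gcongr; exact hδs z hz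
    have h3 := c0_norm_apply_le f z
    rw [mul_one_div, div_le_iff₀ (hden z)]
    nlinarith
  · have h1 : ‖f z‖ ≤ ε / 2 := by
      by_cases hzK : z ∈ K
      · by_contra! hcon
        exact hz ⟨hzK, hcon.le⟩
      · exact (hKf z hzK).le
    refine le_trans (mul_le_of_le_one_right (norm_nonneg _) ?_) h1
    rw [div_le_one (hden z)]
    have := hs0 z
    have : 0 ≤ m * s z := by positivity
    linarith

variable [T2Space Y] [LocallyCompactSpace Y]

theorem exists_c0_bump {K t : Set Y} (hK : IsCompact K) (ht : IsClosed t) (hd : Disjoint K t) :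
    ∃ e : C₀(Y, ℂ), (∀ y ∈ K, e y = 1) ∧ (∀ y ∈ t, e y = 0) ∧ (∀ y, ‖e y‖ ≤ 1) ∧
      ∀ y, ‖1 - e y‖ ≤ 1 := by
  obtain ⟨φ, h1, h0, hcs, h01⟩ := exists_continuous_one_zero_of_isCompact hK ht hd
  refine ⟨⟨⟨fun y => (φ y : ℂ), by fun_prop⟩, ?_⟩, fun y hy => ?_, fun y hy => ?_, fun y => ?_,
    fun y => ?_⟩
  · have := (Complex.continuous_ofReal.tendsto 0).comp hcs.is_zero_at_infty
    simpa using! this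
  · change (φ y : ℂ) = 1
    simp [h1 hy]
  · change (φ y : ℂ) = 0
    simp [h0 hy]
  · change ‖(φ y : ℂ)‖ ≤ 1
    rw [Complex.norm_real, Real.norm_of_nonneg (h01 y).1]
    exact (h01 y).2
  · change ‖1 - (φ y : ℂ)‖ ≤ 1
    rw [← Complex.ofReal_one, ← Complex.ofReal_sub, Complex.norm_real,
      Real.norm_of_nonneg (sub_nonneg.2 (h01 y).2)]
    linarith [(h01 y).1]

theorem exists_c0_apply_eq_one {t : Set Y} (ht : IsClosed t) {y : Y} (hy : y ∉ t) :
    ∃ e : C₀(Y, ℂ), e y = 1 ∧ (∀ z ∈ t, e z = 0) ∧ ∀ z, ‖e z‖ ≤ 1 := by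
  obtain ⟨e, h1, h0, hn, -⟩ := exists_c0_bump (isCompact_singleton (x := y)) ht
    (Set.disjoint_singleton_left.2 hy)
  exact ⟨e, h1 y rfl, h0, hn⟩

theorem exists_c0_approx_unit (f : C₀(Y, ℂ)) {ε : ℝ} (hε : 0 < ε) :
    ∃ e : C₀(Y, ℂ), ‖f - f * e‖ ≤ ε := by
  obtain ⟨K, hK, hKf⟩ := exists_isCompact_norm_lt f hε
  obtain ⟨e, h1, -, -, hn⟩ := exists_c0_bump hK isClosed_empty (Set.disjoint_empty K)
  refine ⟨e, (c0_norm_le _ hε.le).2 fun y => ?_⟩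
  have : (f - f * e) y = f y * (1 - e y) := by
    simp [mul_sub]
  rw [this, norm_mul]
  by_cases hy : y ∈ K
  · simp [h1 y hy, hε.le]
  · calc _ ≤ ‖f y‖ * 1 := by gcongr; exact hn y
      _ ≤ ε := by rw [mul_one]; exact (hKf y hy).le

theorem subset_of_vanishingIdeal_subset {F F' : Set Y} (hF : IsClosed F)
    (h : vanishingIdeal F ⊆ vanishingIdeal F') : F' ⊆ F := by
  intro y hy
  by_contra hyF
  obtain ⟨e, h1, h0, -⟩ := exists_c0_apply_eq_one hF hyF
  exact one_ne_zero (h1.symm.trans (h h0 y hy))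

theorem vanishingIdeal_injOn_isClosed {F F' : Set Y} (hF : IsClosed F) (hF' : IsClosed F')
    (h : vanishingIdeal F = vanishingIdeal F') : F = F' :=
  (subset_of_vanishingIdeal_subset hF' h.ge).antisymm (subset_of_vanishingIdeal_subset hF h.le)

end C0

/-! ### The covering system -/

namespace MultiSystem

variable {n : ℕ} {X : Type u} [TopologicalSpace X]

/-- `f ∘ σ_w` as an element of `C₀(X)`. -/
def pull (S : MultiSystem n X) : List (Fin n) → C₀(X, ℂ) → C₀(X, ℂ)
  | [], f => f
  | i :: w, f => pull S w (S.pullback i f)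

theorem pullback_apply (S : MultiSystem n X) (i : Fin n) (f : C₀(X, ℂ)) (x : X) :
    S.pullback i f x = f (S.map i x) := rfl

theorem pull_apply (S : MultiSystem n X) (w : List (Fin n)) (f : C₀(X, ℂ)) (x : X) :
    S.pull w f x = f (S.wordMap w x) := by
  induction w generalizing f with
  | nil => rfl
  | cons i w ih => rw [pull, ih]; rfl

theorem wordMap_cons (S : MultiSystem n X) (i : Fin n) (w : List (Fin n)) (x : X) :
    S.wordMap (i :: w) x = S.map i (S.wordMap w x) := rfl

theorem wordMap_append (S : MultiSystem n X) (w v : List (Fin n)) (x : X) :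
    S.wordMap (w ++ v) x = S.wordMap w (S.wordMap v x) := by
  simp [wordMap]

variable (S : MultiSystem n X)

/-- `K`, `⋃ i, σ_i⁻¹(K)`, and so on. -/
def preimages (K : Set X) : ℕ → Set X
  | 0 => K
  | k + 1 => ⋃ i, S.map i ⁻¹' preimages K k

theorem isCompact_preimages {K : Set X} (hK : IsCompact K) (k : ℕ) :
    IsCompact (S.preimages K k) := by
  induction k with
  | zero => exact hK
  | succ k ih => exact isCompact_iUnion fun i => (S.isProper i).isCompact_preimage ih

theorem tailMap_eq_iff (i : Fin n) (y z : S.Tail) :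
    S.tailMap i y = z ↔ z.1.1 0 = i ∧ y = S.shift z := by
  constructor
  · rintro rfl
    exact ⟨rfl, rfl⟩
  · rintro ⟨rfl, rfl⟩
    exact S.tailMap_shift z

/-- The preimage of K under τ is the finite union of the compact sets σ̃_i(K). -/
theorem tendsto_shift_cocompact :
    Filter.Tendsto S.shift (Filter.cocompact S.Tail) (Filter.cocompact S.Tail) := by
  intro s hs
  obtain ⟨K, hK, hKs⟩ := Filter.mem_cocompact.1 hs
  refine Filter.mem_cocompact.2 ⟨⋃ i, S.tailMap i '' K,
    isCompact_iUnion fun i => hK.image (S.continuous_tailMap i), ?_⟩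
  intro z hz
  refine hKs fun hzK => hz (Set.mem_iUnion.2 ⟨z.1.1 0, S.shift z, hzK, S.tailMap_shift z⟩)

/-- The first `k` indices of a tail. -/
def initialWord : ℕ → S.Tail → List (Fin n)
  | 0, _ => []
  | k + 1, z => z.1.1 0 :: initialWord k (S.shift z)

theorem length_initialWord (k : ℕ) (z : S.Tail) : (S.initialWord k z).length = k := by
  induction k generalizing z with
  | zero => rfl
  | succ k ih => simp [initialWord, ih]

/-- `f ∘ τ` as an element of `C₀(X̃)`. -/
def shiftPull (f : C₀(S.Tail, ℂ)) : C₀(S.Tail, ℂ) :=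
  f.comp { toFun := S.shift
           continuous_toFun := S.continuous_shift
           cocompact_tendsto' := S.tendsto_shift_cocompact }

/-- The function which is `f ∘ τ` on the range of `σ̃_i` and zero elsewhere. -/
def push (i : Fin n) (f : C₀(S.Tail, ℂ)) : C₀(S.Tail, ℂ) :=
  c0MulBounded (S.shiftPull f) (fun z => if z.1.1 0 = i then 1 else 0)
    ((continuous_of_discreteTopology (f := fun j : Fin n => if j = i then (1 : ℂ) else 0)).comp
      (by fun_prop : Continuous fun z : S.Tail => z.1.1 0)) 1
    fun z => by split_ifs <;> simp

theorem push_apply (i : Fin n) (f : C₀(S.Tail, ℂ)) (z : S.Tail) :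
    S.push i f z = if z.1.1 0 = i then f (S.shift z) else 0 := by
  change f (S.shift z) * (if z.1.1 0 = i then 1 else 0) = _
  split_ifs <;> simp

/-- The function which is `f ∘ τ^{|w|}` on the range of `σ̃_w` and zero elsewhere. -/
def pushWord : List (Fin n) → C₀(S.Tail, ℂ) → C₀(S.Tail, ℂ)
  | [], f => f
  | i :: w, f => S.push i (pushWord w f)

theorem pushWord_apply_eq_or (w : List (Fin n)) (f : C₀(S.Tail, ℂ)) (z : S.Tail) :
    S.pushWord w f z = f (S.shift^[w.length] z) ∨ S.pushWord w f z = 0 := by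
  induction w generalizing z with
  | nil => exact Or.inl rfl
  | cons i w ih =>
    rw [pushWord, push_apply]
    split_ifs
    · exact ih _
    · exact Or.inr rfl

variable [T2Space X]

theorem isClosed_tail : IsClosed {z : (ℕ → Fin n) × (ℕ → X) |
    ∀ k, S.map (z.1 k) (z.2 (k + 1)) = z.2 k} := by
  have hc : Continuous fun p : Fin n × X => S.map p.1 p.2 :=
    continuous_prod_of_discrete_left.2 fun i => (S.isProper i).continuous
  rw [Set.ofPred_forall]
  refine isClosed_iInter fun k => isClosed_eq ?_ (by fun_prop)
  exact hc.comp (f := fun z : (ℕ → Fin n) × (ℕ → X) => (z.1 k, z.2 (k + 1))) (by fun_prop)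

/-- Once x₀ ∈ K, each x_k lies in a finite union of iterated preimages of K under proper maps, so
Tychonoff applies. Local compactness of X̃ follows. -/
theorem isCompact_tail_zero_preimage {K : Set X} (hK : IsCompact K) :
    IsCompact {z : S.Tail | z.1.2 0 ∈ K} := by
  have hC : IsCompact ((Set.univ : Set (ℕ → Fin n)) ×ˢ Set.univ.pi (S.preimages K)) :=
    isCompact_univ.prod (isCompact_univ_pi fun k => S.isCompact_preimages hK k)
  refine (S.isClosed_tail.isClosedEmbedding_subtypeVal.isCompact_preimage hC).of_isClosed_subset
    (hK.isClosed.preimage (by fun_prop)) ?_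
  intro z hz
  refine ⟨trivial, fun k _ => ?_⟩
  induction k with
  | zero => exact hz
  | succ k ih =>
    refine Set.mem_iUnion.2 ⟨z.1.1 k, ?_⟩
    change S.map (z.1.1 k) (z.1.2 (k + 1)) ∈ S.preimages K k
    rw [z.2 k]
    exact ih trivial

instance [LocallyCompactSpace X] : LocallyCompactSpace S.Tail :=
  have : WeaklyLocallyCompactSpace S.Tail := ⟨fun z => by
    obtain ⟨K, hK, hKz⟩ := exists_compact_mem_nhds (z.1.2 0)
    refine ⟨_, S.isCompact_tail_zero_preimage hK, ?_⟩
    have hc : Continuous fun z : S.Tail => z.1.2 0 := by fun_prop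
    exact hc.continuousAt.preimage_mem_nhds hKz⟩
  inferInstance

theorem pullback_shiftPull (i : Fin n) (f : C₀(S.Tail, ℂ)) :
    S.cover.pullback i (S.shiftPull f) = f := rfl

theorem pullback_push (i j : Fin n) (f : C₀(S.Tail, ℂ)) :
    S.cover.pullback j (S.push i f) = if j = i then f else 0 := by
  ext z
  rw [pullback_apply, push_apply]
  change (if j = i then f z else 0) = _
  split_ifs <;> rfl

theorem pushWord_apply_wordMap (w : List (Fin n)) (f : C₀(S.Tail, ℂ)) (z : S.Tail) :
    S.pushWord w f (S.cover.wordMap w z) = f z := by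
  induction w with
  | nil => rfl
  | cons i w ih =>
    rw [pushWord, push_apply, wordMap_cons]
    exact (if_pos rfl).trans ih

theorem shift_iterate_wordMap (w : List (Fin n)) (z : S.Tail) :
    S.shift^[w.length] (S.cover.wordMap w z) = z := by
  induction w with
  | nil => rfl
  | cons i w ih => exact ih

theorem wordMap_initialWord (k : ℕ) (z : S.Tail) :
    S.cover.wordMap (S.initialWord k z) (S.shift^[k] z) = z := by
  induction k generalizing z with
  | zero => rfl
  | succ k ih =>
    rw [initialWord, wordMap_cons, Function.iterate_succ_apply, ih]
    exact S.tailMap_shift z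

/-- A point of X̃ records the letters applied to it, so the word can be read off once its length is
known. Equal length is needed: a periodic point is fixed by a nonempty word. -/
theorem wordMap_injective {w v : List (Fin n)} {z : S.Tail} (hl : w.length = v.length)
    (h : S.cover.wordMap w z = S.cover.wordMap v z) : w = v := by
  induction w generalizing v with
  | nil => exact (List.length_eq_zero_iff.1 hl.symm).symm
  | cons i w ih =>
    cases v with
    | nil => simp at hl
    | cons j v =>
      rw [wordMap_cons, wordMap_cons] at h
      obtain ⟨h1, h2⟩ := (S.tailMap_eq_iff i _ _).1 h
      exact congrArg₂ _ h1.symm (ih (by simpa using hl) h2)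

end MultiSystem

end

noncomputable section

/-! ### Multiplication and composition operators on `ℓ²` -/

section EllTwo

variable {Ω : Type u}

/-- The Hilbert space `ℓ²(Ω)`. -/
abbrev EllTwo (Ω : Type u) : Type u := lp (fun _ : Ω => ℂ) 2

theorem memℓp_two_iff {f : Ω → ℂ} : Memℓp f 2 ↔ Summable fun ω => ‖f ω‖ ^ 2 := by
  rw [memℓp_gen_iff (by norm_num)]
  simp

theorem EllTwo.summable_sq (f : EllTwo Ω) : Summable fun ω => ‖f ω‖ ^ 2 :=
  memℓp_two_iff.1 (lp.memℓp f)

theorem EllTwo.norm_sq (f : EllTwo Ω) : ‖f‖ ^ 2 = ∑' ω, ‖f ω‖ ^ 2 := by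
  have := lp.norm_rpow_eq_tsum (p := 2) (by norm_num) f
  simpa using this

/-- Multiplication by a bounded function. -/
def EllTwo.mulOp (φ : Ω → ℂ) (c : ℝ) (hc : 0 ≤ c) (hφ : ∀ ω, ‖φ ω‖ ≤ c) :
    EllTwo Ω →L[ℂ] EllTwo Ω :=
  have hle : ∀ (f : EllTwo Ω) ω, ‖φ ω * f ω‖ ^ 2 ≤ c ^ 2 * ‖f ω‖ ^ 2 := fun f ω => by
    rw [norm_mul, mul_pow]
    gcongr
    exact hφ ω
  have hs : ∀ f : EllTwo Ω, Summable fun ω => ‖φ ω * f ω‖ ^ 2 := fun f =>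
    Summable.of_nonneg_of_le (fun _ => by positivity) (hle f) ((summable_sq f).mul_left _)
  LinearMap.mkContinuous
    { toFun := fun f => ⟨fun ω => φ ω * f ω, memℓp_two_iff.2 (hs f)⟩
      map_add' := fun f g => by ext ω; exact mul_add _ _ _
      map_smul' := fun a f => by ext ω; simp [mul_left_comm] } c fun f => by
    refine le_of_sq_le_sq ?_ (by positivity)
    rw [mul_pow, norm_sq, norm_sq, ← tsum_mul_left]
    exact (hs f).tsum_le_tsum (hle f) ((summable_sq f).mul_left _)

theorem EllTwo.mulOp_apply (φ : Ω → ℂ) (c : ℝ) (hc : 0 ≤ c) (hφ : ∀ ω, ‖φ ω‖ ≤ c) (f : EllTwo Ω)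
    (ω : Ω) : mulOp φ c hc hφ f ω = φ ω * f ω := rfl

/-- Composition with an injective map. -/
def EllTwo.compOp (s : Ω → Ω) (hs : Function.Injective s) : EllTwo Ω →L[ℂ] EllTwo Ω :=
  have hsum : ∀ f : EllTwo Ω, Summable fun ω => ‖f (s ω)‖ ^ 2 := fun f =>
    (summable_sq f).comp_injective hs
  LinearMap.mkContinuous
    { toFun := fun f => ⟨fun ω => f (s ω), memℓp_two_iff.2 (hsum f)⟩
      map_add' := fun f g => by ext ω; rfl
      map_smul' := fun a f => by ext ω; simp } 1 fun f => by
    refine le_of_sq_le_sq ?_ (by positivity)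
    rw [one_mul, norm_sq, norm_sq]
    exact tsum_comp_le_tsum_of_inj (summable_sq f) (fun _ => by positivity) hs

theorem EllTwo.compOp_apply (s : Ω → Ω) (hs : Function.Injective s) (f : EllTwo Ω) (ω : Ω) :
    compOp s hs f ω = f (s ω) := rfl

open Classical in
/-- The basis vector at a point. -/
def EllTwo.basisVec (ω : Ω) : EllTwo Ω := lp.single 2 ω 1

open Classical in
theorem EllTwo.inner_basisVec (ω : Ω) (f : EllTwo Ω) : inner ℂ (basisVec ω) f = f ω := by
  rw [basisVec, lp.inner_single_left]
  simp

open Classical in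
theorem EllTwo.basisVec_apply (ω ω' : Ω) : basisVec ω ω' = if ω' = ω then 1 else 0 := by
  rw [basisVec, lp.single_apply, Pi.single_apply]

theorem EllTwo.star_compOp_basisVec (s : Ω → Ω) (hs : Function.Injective s) (ω : Ω) :
    star (compOp s hs) (basisVec ω) = basisVec (s ω) := by
  refine ext_inner_right ℂ fun f => ?_
  rw [ContinuousLinearMap.star_eq_adjoint, ContinuousLinearMap.adjoint_inner_left,
    inner_basisVec, inner_basisVec, compOp_apply]

theorem EllTwo.star_compOp_apply (s : Ω → Ω) (hs : Function.Injective s) (f : EllTwo Ω) (ω : Ω) :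
    star (compOp s hs) f (s ω) = f ω := by
  have h : compOp s hs (basisVec (s ω)) = basisVec ω := by
    ext ω'
    rw [compOp_apply, basisVec_apply, basisVec_apply]
    by_cases h : ω' = ω
    · simp [h]
    · rw [if_neg h, if_neg (hs.ne h)]
  rw [← inner_basisVec, ContinuousLinearMap.star_eq_adjoint,
    ContinuousLinearMap.adjoint_inner_right, h, inner_basisVec]

theorem EllTwo.star_compOp_apply_of_notMem (s : Ω → Ω) (hs : Function.Injective s) (f : EllTwo Ω)
    (ω : Ω) (hω : ω ∉ Set.range s) : star (compOp s hs) f ω = 0 := by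
  have h : compOp s hs (basisVec ω) = 0 := by
    ext ω'
    rw [compOp_apply, basisVec_apply, if_neg fun h => hω ⟨ω', h⟩]
    rfl
  rw [← inner_basisVec, ContinuousLinearMap.star_eq_adjoint,
    ContinuousLinearMap.adjoint_inner_right, h, inner_zero_left]

end EllTwo

/-! ### The regular representation of the covering system -/

namespace MultiSystem

variable {n : ℕ} {X : Type u} [TopologicalSpace X] (S : MultiSystem n X)

/-- `(x, k) ↦ (σ̃_i(x), k + 1)`. -/
def gradedMap (i : Fin n) (p : S.Tail × ℤ) : S.Tail × ℤ := (S.tailMap i p.1, p.2 + 1)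

theorem gradedMap_eq_iff (i : Fin n) (p q : S.Tail × ℤ) :
    S.gradedMap i p = q ↔ q.1.1.1 0 = i ∧ p = (S.shift q.1, q.2 - 1) := by
  rw [gradedMap, Prod.ext_iff, Prod.ext_iff, S.tailMap_eq_iff, and_assoc]
  simp only [eq_sub_iff_add_eq]

theorem gradedMap_injective (i : Fin n) : Function.Injective (S.gradedMap i) := by
  intro p q h
  exact (((S.gradedMap_eq_iff i p _).1 h).2).trans (((S.gradedMap_eq_iff i q _).1 rfl).2).symm

/-- The multiplication representation of `C₀(X̃)` on `ℓ²(X̃ × ℤ)`. -/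
def regularPi : C₀(S.Tail, ℂ) →⋆ₙₐ[ℂ] (EllTwo (S.Tail × ℤ) →L[ℂ] EllTwo (S.Tail × ℤ)) where
  toFun f := EllTwo.mulOp (fun p => f p.1) ‖f‖ (norm_nonneg f) fun p => c0_norm_apply_le f p.1
  map_smul' c f := by
    ext h p
    exact mul_assoc _ _ _
  map_zero' := by
    ext h p
    exact zero_mul _
  map_add' f g := by
    ext h p
    exact add_mul _ _ _
  map_mul' f g := by
    ext h p
    exact mul_assoc _ _ _
  map_star' f := by
    refine ContinuousLinearMap.ext fun x => ext_inner_left ℂ fun y => ?_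
    rw [ContinuousLinearMap.star_eq_adjoint, ContinuousLinearMap.adjoint_inner_right,
      lp.inner_eq_tsum, lp.inner_eq_tsum]
    refine tsum_congr fun p => ?_
    rw [EllTwo.mulOp_apply, EllTwo.mulOp_apply, ZeroAtInftyContinuousMap.star_apply]
    simp only [RCLike.inner_apply, map_mul, Complex.star_def]
    ring

theorem regularPi_apply (f : C₀(S.Tail, ℂ)) (h : EllTwo (S.Tail × ℤ)) (p : S.Tail × ℤ) :
    S.regularPi f h p = f p.1 * h p := rfl

theorem regularPi_basisVec (f : C₀(S.Tail, ℂ)) (p : S.Tail × ℤ) :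
    S.regularPi f (EllTwo.basisVec p) = f p.1 • EllTwo.basisVec p := by
  ext q
  rw [regularPi_apply, lp.coeFn_smul, Pi.smul_apply, EllTwo.basisVec_apply]
  split_ifs with h
  · rw [h]; rfl
  · simp

/-- The generating isometries on `ℓ²(X̃ × ℤ)`. -/
def regularT (i : Fin n) : EllTwo (S.Tail × ℤ) →L[ℂ] EllTwo (S.Tail × ℤ) :=
  star (EllTwo.compOp (S.gradedMap i) (S.gradedMap_injective i))

theorem regularT_apply (i : Fin n) (h : EllTwo (S.Tail × ℤ)) (p : S.Tail × ℤ) :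
    S.regularT i h p = if p.1.1.1 0 = i then h (S.shift p.1, p.2 - 1) else 0 := by
  split_ifs with hi
  · have := (S.gradedMap_eq_iff i (S.shift p.1, p.2 - 1) p).2 ⟨hi, rfl⟩
    conv_lhs => rw [← this]
    exact EllTwo.star_compOp_apply _ _ _ _
  · refine EllTwo.star_compOp_apply_of_notMem _ _ _ _ ?_
    rintro ⟨q, hq⟩
    exact hi ((S.gradedMap_eq_iff i q p).1 hq).1

theorem star_regularT_apply (i : Fin n) (h : EllTwo (S.Tail × ℤ)) (p : S.Tail × ℤ) :
    star (S.regularT i) h p = h (S.tailMap i p.1, p.2 + 1) := by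
  rw [regularT, star_star]
  rfl

theorem regularT_basisVec (i : Fin n) (p : S.Tail × ℤ) :
    S.regularT i (EllTwo.basisVec p) = EllTwo.basisVec (S.tailMap i p.1, p.2 + 1) :=
  EllTwo.star_compOp_basisVec _ _ _

theorem star_regularT_mul_regularT (i j : Fin n) :
    star (S.regularT i) * S.regularT j = if i = j then 1 else 0 := by
  ext h p
  rw [mul_apply_eq_comp, star_regularT_apply, regularT_apply]
  change (if i = j then h (p.1, p.2 + 1 - 1) else 0) = _
  rw [add_sub_cancel_right]
  split_ifs <;> rfl

/-- Each point lies in the range of exactly one σ̃_i, the one named by its first letter. -/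
theorem sum_regularT_mul_star : ∑ i, S.regularT i * star (S.regularT i) = 1 := by
  refine ContinuousLinearMap.ext fun h => ?_
  rw [sum_apply]
  ext p
  rw [lp.coeFn_sum, Finset.sum_apply, Finset.sum_eq_single (p.1.1.1 0)]
  · rw [mul_apply_eq_comp, regularT_apply, if_pos rfl, star_regularT_apply]
    simp only [S.tailMap_shift, sub_add_cancel]
    rfl
  · intro i _ hi
    rw [mul_apply_eq_comp, regularT_apply, if_neg hi.symm]
  · simp

variable [T2Space X]

/-- The regular representation of the covering system on `ℓ²(X̃ × ℤ)`. -/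
def regularRep : RowRep S.cover (EllTwo (S.Tail × ℤ)) where
  π := S.regularPi
  T := S.regularT
  covariant i f := by
    ext h p
    simp only [mul_apply_eq_comp, regularPi_apply, regularT_apply]
    split_ifs with hi
    · rw [pullback_apply]
      subst hi
      congr 2
      exact (S.tailMap_shift p.1).symm
    · simp
  row_contractive h := by
    have hin : ∀ i j, inner ℂ (S.regularT i (h i)) (S.regularT j (h j)) =
        if i = j then inner ℂ (h i) (h i) else 0 := by
      intro i j
      rw [← ContinuousLinearMap.adjoint_inner_right, ← ContinuousLinearMap.star_eq_adjoint,
        ← mul_apply_eq_comp, star_regularT_mul_regularT]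
      split_ifs with hij
      · subst hij; rfl
      · simp
    refine le_of_eq ?_
    have : (((‖∑ i, S.regularT i (h i)‖ ^ 2 : ℝ)) : ℂ) = ((∑ i, ‖h i‖ ^ 2 : ℝ) : ℂ) := by
      push_cast
      rw [← Complex.coe_algebraMap, ← inner_self_eq_norm_sq_to_K, sum_inner]
      simp only [inner_sum, hin, Finset.sum_ite_eq, Finset.mem_univ, if_true]
      simp [inner_self_eq_norm_sq_to_K]
    exact_mod_cast this

end MultiSystem

end

noncomputable section

/-! ### Words -/

/-- The words of length `k` in `n` letters. -/
def words (n : ℕ) : ℕ → Finset (List (Fin n))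
  | 0 => {[]}
  | k + 1 => (words n k ×ˢ Finset.univ).image fun p => p.1 ++ [p.2]

theorem mem_words {n k : ℕ} {w : List (Fin n)} : w ∈ words n k ↔ w.length = k := by
  induction k generalizing w with
  | zero => simp [words, List.length_eq_zero_iff]
  | succ k ih =>
    simp only [words, Finset.mem_image, Finset.mem_product, ih, Finset.mem_univ, and_true]
    constructor
    · rintro ⟨p, hp, rfl⟩
      simp [hp]
    · intro hw
      rcases List.eq_nil_or_concat w with rfl | ⟨v, i, rfl⟩
      · simp at hw
      · exact ⟨(v, i), by simpa using hw, by simp⟩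

theorem sum_words_succ {n : ℕ} {A : Type*} [AddCommMonoid A] (k : ℕ) (F : List (Fin n) → A) :
    ∑ w ∈ words n (k + 1), F w = ∑ w ∈ words n k, ∑ i, F (w ++ [i]) := by
  rw [words, Finset.sum_image, Finset.sum_product]
  rintro ⟨v, i⟩ _ ⟨w, j⟩ _ h
  simpa [List.append_singleton_inj] using h

/-- The words of length less than `k` in `n` letters. -/
def wordsLT (n k : ℕ) : Finset (List (Fin n)) := (Finset.range k).biUnion (words n)

theorem mem_wordsLT {n k : ℕ} {w : List (Fin n)} : w ∈ wordsLT n k ↔ w.length < k := by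
  simp [wordsLT, mem_words]

theorem sum_wordsLT {n : ℕ} {A : Type*} [AddCommMonoid A] (k : ℕ) (F : List (Fin n) → A) :
    ∑ w ∈ wordsLT n k, F w = ∑ l ∈ Finset.range k, ∑ w ∈ words n l, F w := by
  rw [wordsLT, Finset.sum_biUnion]
  intro l _ l' _ hl
  refine Finset.disjoint_left.2 fun w hw hw' => hl ?_
  rw [← mem_words.1 hw, ← mem_words.1 hw']

/-! ### Norm estimates by sesquilinear forms -/

theorem opNorm_le_of_inner_le {E : Type*} [NormedAddCommGroup E] [InnerProductSpace ℂ E]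
    (A : E →L[ℂ] E) {c : ℝ} (hc : 0 ≤ c) (h : ∀ x z, ‖inner ℂ z (A x)‖ ≤ c * ‖x‖ * ‖z‖) :
    ‖A‖ ≤ c := by
  refine A.opNorm_le_bound hc fun x => ?_
  rcases eq_or_ne (A x) 0 with h0 | h0
  · rw [h0, norm_zero]
    positivity
  · have := h x (A x)
    rw [inner_self_eq_norm_sq_to_K, norm_pow, RCLike.norm_ofReal, abs_norm, sq] at this
    exact le_of_mul_le_mul_right this (norm_pos_iff.2 h0)

section

open scoped Matrix.Norms.L2Operator

theorem matrix_norm_le_of_sum_le {ι : Type*} [Fintype ι] [DecidableEq ι] (A : Matrix ι ι ℂ)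
    {c : ℝ} (hc : 0 ≤ c)
    (h : ∀ η ξ : ι → ℂ, ‖∑ p, ∑ q, star (ξ p) * (A p q * η q)‖ ≤
      c * √(∑ q, ‖η q‖ ^ 2) * √(∑ p, ‖ξ p‖ ^ 2)) : ‖A‖ ≤ c := by
  rw [← Matrix.l2_opNorm_toEuclideanCLM]
  refine opNorm_le_of_inner_le _ hc fun x z => ?_
  have := h x z
  rw [← EuclideanSpace.norm_eq, ← EuclideanSpace.norm_eq] at this
  convert! this using 2
  simp only [PiLp.inner_apply, RCLike.inner_apply, Matrix.ofLp_toEuclideanCLM, Matrix.mulVec,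
    dotProduct, Finset.sum_mul]
  refine Finset.sum_congr rfl fun p _ => Finset.sum_congr rfl fun q _ => ?_
  rw [mul_comm]
  rfl

end

/-! ### Row contractive representations -/

namespace RowRep

section General

variable {n : ℕ} {Y : Type u} [TopologicalSpace Y] {S : MultiSystem n Y}
  {H : Type u} [NormedAddCommGroup H] [InnerProductSpace ℂ H] [CompleteSpace H] (ρ : RowRep S H)

theorem word_nil : ρ.word [] = 1 := rfl

theorem word_cons (i : Fin n) (w : List (Fin n)) : ρ.word (i :: w) = ρ.T i * ρ.word w := by
  simp [word]

theorem word_append (w v : List (Fin n)) : ρ.word (w ++ v) = ρ.word w * ρ.word v := by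
  simp [word]

theorem word_singleton (i : Fin n) : ρ.word [i] = ρ.T i := by
  simp [word]

theorem π_mul_word (w : List (Fin n)) (f : C₀(Y, ℂ)) :
    ρ.π f * ρ.word w = ρ.word w * ρ.π (S.pull w f) := by
  induction w generalizing f with
  | nil => simp [word_nil, MultiSystem.pull]
  | cons i w ih => rw [word_cons, ← mul_assoc, ρ.covariant, mul_assoc, ih, mul_assoc]; rfl

theorem pull_star (w : List (Fin n)) (f : C₀(Y, ℂ)) : S.pull w (star f) = star (S.pull w f) := by
  ext y
  simp [MultiSystem.pull_apply]

theorem star_word_mul_π (w : List (Fin n)) (f : C₀(Y, ℂ)) :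
    star (ρ.word w) * ρ.π f = ρ.π (S.pull w f) * star (ρ.word w) := by
  have := congrArg star (ρ.π_mul_word w (star f))
  rwa [star_mul, star_mul, pull_star, map_star, map_star, star_star, star_star] at this

theorem inner_apply_eq_inner_star (A : H →L[ℂ] H) (x z : H) :
    inner ℂ z (A x) = inner ℂ (star A z) x := by
  rw [ContinuousLinearMap.star_eq_adjoint, ContinuousLinearMap.adjoint_inner_left]

/-- The adjoint of a row contraction is a column contraction: Cauchy–Schwarz gives s² ≤ ‖h‖² s for
the left side s. -/
theorem sum_norm_star_T_sq_le (h : H) : ∑ i, ‖star (ρ.T i) h‖ ^ 2 ≤ ‖h‖ ^ 2 := by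
  set s := ∑ i, ‖star (ρ.T i) h‖ ^ 2 with hs
  have hs0 : 0 ≤ s := Finset.sum_nonneg fun i _ => by positivity
  have h1 : ‖∑ i, ρ.T i (star (ρ.T i) h)‖ ^ 2 ≤ s := ρ.row_contractive fun i => star (ρ.T i) h
  have h2 : (s : ℂ) = inner ℂ h (∑ i, ρ.T i (star (ρ.T i) h)) := by
    rw [inner_sum, hs]
    push_cast
    refine Finset.sum_congr rfl fun i _ => ?_
    rw [inner_apply_eq_inner_star, inner_self_eq_norm_sq_to_K]
    rfl
  have h3 : s ≤ ‖h‖ * ‖∑ i, ρ.T i (star (ρ.T i) h)‖ := by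
    have := norm_inner_le_norm (𝕜 := ℂ) h (∑ i, ρ.T i (star (ρ.T i) h))
    rwa [← h2, Complex.norm_real, Real.norm_of_nonneg hs0] at this
  have h4 : s ^ 2 ≤ ‖h‖ ^ 2 * s := by
    calc s ^ 2 ≤ (‖h‖ * ‖∑ i, ρ.T i (star (ρ.T i) h)‖) ^ 2 := by gcongr
      _ = ‖h‖ ^ 2 * ‖∑ i, ρ.T i (star (ρ.T i) h)‖ ^ 2 := by ring
      _ ≤ _ := by gcongr
  rcases hs0.eq_or_lt with h0 | h0
  · rw [← h0]; positivity
  · rw [sq] at h4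
    exact le_of_mul_le_mul_right h4 h0

theorem sum_norm_star_word_sq_le (k : ℕ) (h : H) :
    ∑ w ∈ words n k, ‖star (ρ.word w) h‖ ^ 2 ≤ ‖h‖ ^ 2 := by
  induction k with
  | zero => simp [words, word_nil]
  | succ k ih =>
    rw [sum_words_succ]
    refine le_trans (Finset.sum_le_sum fun w _ => ?_) ih
    have := ρ.sum_norm_star_T_sq_le (star (ρ.word w) h)
    simpa [word_append, word_singleton, star_mul, mul_apply_eq_comp] using this

/-- D is the square root of the positive operator 1 - r² ∑ T_i T_i^*. Covariance makes each T_i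
T_i^* commute with π, and functional calculus passes this on to D. -/
theorem exists_defect (r : ℝ) (hr0 : 0 ≤ r) (hr1 : r ≤ 1) : ∃ D : H →L[ℂ] H, star D = D ∧
    D * D = 1 - ((r ^ 2 : ℝ) : ℂ) • ∑ i, ρ.T i * star (ρ.T i) ∧ ∀ f, Commute D (ρ.π f) := by
  set B : H →L[ℂ] H := 1 - ((r ^ 2 : ℝ) : ℂ) • ∑ i, ρ.T i * star (ρ.T i) with hB
  have hin : ∀ x, inner ℂ x (B x) = ((‖x‖ ^ 2 - r ^ 2 * ∑ i, ‖star (ρ.T i) x‖ ^ 2 : ℝ) : ℂ) := by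
    intro x
    simp only [hB, sub_apply, one_apply_eq_self, smul_apply,
      sum_apply, mul_apply_eq_comp, inner_sub_right, inner_smul_right, inner_sum,
      inner_apply_eq_inner_star, inner_self_eq_norm_sq_to_K]
    push_cast
    rfl
  have hpos : 0 ≤ B := by
    rw [ContinuousLinearMap.nonneg_iff_isPositive, ContinuousLinearMap.isPositive_iff_complex]
    intro x
    have hx : inner ℂ (B x) x =
        ((‖x‖ ^ 2 - r ^ 2 * ∑ i, ‖star (ρ.T i) x‖ ^ 2 : ℝ) : ℂ) := by
      rw [← inner_conj_symm, hin, Complex.conj_ofReal]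
    rw [hx]
    refine ⟨rfl, ?_⟩
    have h1 := ρ.sum_norm_star_T_sq_le x
    have h2 : r ^ 2 ≤ 1 := pow_le_one₀ hr0 hr1
    have h3 : 0 ≤ ∑ i, ‖star (ρ.T i) x‖ ^ 2 := Finset.sum_nonneg fun i _ => by positivity
    change 0 ≤ ‖x‖ ^ 2 - r ^ 2 * ∑ i, ‖star (ρ.T i) x‖ ^ 2
    nlinarith
  have hcomm : ∀ f, Commute B (ρ.π f) := by
    intro f
    refine (Commute.one_left _).sub_left (Commute.smul_left ?_ _)
    refine Commute.sum_left _ _ _ fun i _ => ?_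
    have h1 := ρ.π_mul_word [i] f
    have h2 := ρ.star_word_mul_π [i] f
    rw [word_singleton] at h1 h2
    rw [commute_iff_eq, mul_assoc, h2, ← mul_assoc, ← h1, mul_assoc]
  refine ⟨CFC.sqrt B, ?_, CFC.sqrt_mul_sqrt_self B hpos, fun f => ?_⟩
  · exact (IsSelfAdjoint.of_nonneg (CFC.sqrt_nonneg B)).star_eq
  · rw [CFC.sqrt_eq_cfc]
    exact (hcomm f).cfc_nnreal _

/-- The coefficient at the word `v` of the Poisson kernel. -/
def poisson (r : ℝ) (D : H →L[ℂ] H) (v : List (Fin n)) (h : H) : H :=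
  ((r ^ v.length : ℝ) : ℂ) • D (star (ρ.word v) h)

/-- The sum telescopes, since ⟨Da, Db⟩ = ⟨a, b⟩ - r² ∑ ⟨T_i^* a, T_i^* b⟩. For r < 1 the remainder
tends to 0, so the Poisson kernel is an isometry into Fock space. -/
theorem sum_inner_poisson {r : ℝ} {D : H →L[ℂ] H} (hD : star D = D)
    (hDD : D * D = 1 - ((r ^ 2 : ℝ) : ℂ) • ∑ i, ρ.T i * star (ρ.T i)) (N : ℕ) (x z : H) :
    ∑ v ∈ wordsLT n N, inner ℂ (ρ.poisson r D v z) (ρ.poisson r D v x) = inner ℂ z x -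
      ((r ^ (2 * N) : ℝ) : ℂ) *
        ∑ v ∈ words n N, inner ℂ (star (ρ.word v) z) (star (ρ.word v) x) := by
  rw [sum_wordsLT]
  induction N with
  | zero => simp [words, word_nil]
  | succ N ih =>
    have hterm : ∀ v ∈ words n N, inner ℂ (ρ.poisson r D v z) (ρ.poisson r D v x) =
        ((r ^ (2 * N) : ℝ) : ℂ) * inner ℂ (star (ρ.word v) z) (star (ρ.word v) x) -
        ((r ^ (2 * (N + 1)) : ℝ) : ℂ) *
          ∑ i, inner ℂ (star (ρ.word (v ++ [i])) z) (star (ρ.word (v ++ [i])) x) := by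
      intro v hv
      have h1 : ∀ a b : H, inner ℂ (D a) (D b) =
          inner ℂ a b - ((r ^ 2 : ℝ) : ℂ) * ∑ i, inner ℂ (star (ρ.T i) a) (star (ρ.T i) b) := by
        intro a b
        conv_lhs => rw [← hD]
        rw [← inner_apply_eq_inner_star]
        rw [hD, ← mul_apply_eq_comp, hDD]
        simp only [sub_apply, one_apply_eq_self,
          smul_apply, sum_apply, mul_apply_eq_comp, inner_sub_right,
          inner_smul_right, inner_sum, inner_apply_eq_inner_star]
      simp only [poisson, inner_smul_left, inner_smul_right, h1, mem_words.1 hv, word_append,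
        word_singleton, star_mul, mul_apply_eq_comp, Complex.conj_ofReal]
      push_cast
      ring
    rw [Finset.sum_range_succ, ih, Finset.sum_congr rfl hterm, Finset.sum_sub_distrib,
      ← Finset.mul_sum, ← Finset.mul_sum, sum_words_succ]
    ring

theorem tendsto_sum_inner_poisson {r : ℝ} (hr0 : 0 ≤ r) (hr1 : r < 1) {D : H →L[ℂ] H}
    (hD : star D = D) (hDD : D * D = 1 - ((r ^ 2 : ℝ) : ℂ) • ∑ i, ρ.T i * star (ρ.T i)) (x z : H) :
    Filter.Tendsto (fun N => ∑ v ∈ wordsLT n N,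
      inner ℂ (ρ.poisson r D v z) (ρ.poisson r D v x)) Filter.atTop (nhds (inner ℂ z x)) := by
  simp only [ρ.sum_inner_poisson hD hDD]
  have h : Filter.Tendsto (fun N => ((r ^ (2 * N) : ℝ) : ℂ) *
      ∑ v ∈ words n N, inner ℂ (star (ρ.word v) z) (star (ρ.word v) x)) Filter.atTop (nhds 0) := by
    refine squeeze_zero_norm (a := fun N => (r ^ 2) ^ N * (‖z‖ * ‖x‖)) (fun N => ?_) ?_
    · rw [norm_mul, Complex.norm_real, Real.norm_of_nonneg (by positivity), pow_mul]
      gcongr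
      refine (norm_sum_le _ _).trans
        ((Finset.sum_le_sum fun v _ => norm_inner_le_norm _ _).trans ?_)
      refine (Real.sum_mul_le_sqrt_mul_sqrt _ _ _).trans ?_
      refine mul_le_mul ?_ ?_ (Real.sqrt_nonneg _) (norm_nonneg _)
      · exact Real.sqrt_le_iff.2 ⟨norm_nonneg _, ρ.sum_norm_star_word_sq_le N z⟩
      · exact Real.sqrt_le_iff.2 ⟨norm_nonneg _, ρ.sum_norm_star_word_sq_le N x⟩
    · have := (tendsto_pow_atTop_nhds_zero_of_lt_one (r := r ^ 2) (by positivity)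
        (by nlinarith)).mul_const (‖z‖ * ‖x‖)
      simpa using this
  simpa using tendsto_const_nhds.sub h

theorem sum_norm_poisson_sq_le {r : ℝ} {D : H →L[ℂ] H} (hD : star D = D)
    (hDD : D * D = 1 - ((r ^ 2 : ℝ) : ℂ) • ∑ i, ρ.T i * star (ρ.T i)) (N : ℕ) (x : H) :
    ∑ v ∈ wordsLT n N, ‖ρ.poisson r D v x‖ ^ 2 ≤ ‖x‖ ^ 2 := by
  have h := ρ.sum_inner_poisson hD hDD N x x
  simp only [inner_self_eq_norm_sq_to_K] at h
  have h' : ∑ v ∈ wordsLT n N, ‖ρ.poisson r D v x‖ ^ 2 =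
      ‖x‖ ^ 2 - r ^ (2 * N) * ∑ v ∈ words n N, ‖star (ρ.word v) x‖ ^ 2 := by
    have : ((∑ v ∈ wordsLT n N, ‖ρ.poisson r D v x‖ ^ 2 : ℝ) : ℂ) =
        ((‖x‖ ^ 2 - r ^ (2 * N) * ∑ v ∈ words n N, ‖star (ρ.word v) x‖ ^ 2 : ℝ) : ℂ) := by
      push_cast
      push_cast at h
      exact h
    exact_mod_cast this
  rw [h', pow_mul]
  have : 0 ≤ (r ^ 2) ^ N * ∑ v ∈ words n N, ‖star (ρ.word v) x‖ ^ 2 :=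
    mul_nonneg (by positivity) (Finset.sum_nonneg fun v _ => by positivity)
  linarith

/-- The Poisson kernel intertwines r^{|w|} T_w^* with the adjoint of creation by w on Fock space. -/
theorem poisson_append (r : ℝ) (D : H →L[ℂ] H) (w v : List (Fin n)) (z : H) :
    ρ.poisson r D (w ++ v) z = ((r ^ w.length : ℝ) : ℂ) • ρ.poisson r D v (star (ρ.word w) z) := by
  simp only [poisson, List.length_append, word_append, star_mul, mul_apply_eq_comp, smul_smul]
  congr 1
  push_cast
  ring

/-- It also intertwines π with the Fock representation acting by f ∘ σ_v on the coordinate v. -/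
theorem π_pull_poisson (r : ℝ) {D : H →L[ℂ] H} (hD : ∀ f, Commute D (ρ.π f)) (v : List (Fin n))
    (f : C₀(Y, ℂ)) (x : H) :
    ρ.π (S.pull v f) (ρ.poisson r D v x) = ρ.poisson r D v (ρ.π f x) := by
  rw [poisson, poisson, map_smul, ← mul_apply_eq_comp, ← (hD _).eq, mul_apply_eq_comp,
    ← mul_apply_eq_comp (star (ρ.word v)), star_word_mul_π, mul_apply_eq_comp]

theorem inner_evalMatrix {m : ℕ} (a : Matrix (Fin m) (Fin m) S.CovAlg)
    (x z : PiLp 2 fun _ : Fin m => H) :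
    inner ℂ z (ρ.evalMatrix a x) = ∑ i, ∑ j, inner ℂ (z i) (ρ.eval (a i j) (x j)) :=
  inner_matOp (fun i j => ρ.eval (a i j)) x z

end General

end RowRep

end

noncomputable section

open scoped Matrix.Norms.L2Operator

/-! ### Fock matrices as compressions of the regular representation -/

namespace MultiSystem

variable {n : ℕ} {X : Type u} [TopologicalSpace X] [T2Space X] (S : MultiSystem n X)

theorem regularRep_word_basisVec (w : List (Fin n)) (p : S.Tail × ℤ) :
    S.regularRep.word w (EllTwo.basisVec p) =
      EllTwo.basisVec (S.cover.wordMap w p.1, p.2 + w.length) := by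
  induction w with
  | nil => simp [RowRep.word_nil, wordMap]
  | cons i w ih =>
    rw [RowRep.word_cons, mul_apply_eq_comp, ih]
    refine (S.regularT_basisVec i _).trans ?_
    rw [wordMap_cons, List.length_cons]
    congr 2
    push_cast
    ring

theorem regularRep_eval_basisVec (a : S.cover.CovAlg) (p : S.Tail × ℤ) :
    S.regularRep.eval a (EllTwo.basisVec p) = a.sum fun w f =>
      f p.1 • EllTwo.basisVec (S.cover.wordMap w p.1, p.2 + (w.length : ℤ)) := by
  rw [RowRep.eval, Finsupp.sum, Finsupp.sum, sum_apply]
  refine Finset.sum_congr rfl fun w _ => ?_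
  rw [mul_apply_eq_comp]
  have : S.regularRep.π (a w) (EllTwo.basisVec p) = a w p.1 • EllTwo.basisVec p :=
    S.regularPi_basisVec _ _
  rw [this, map_smul, regularRep_word_basisVec]

/-- The basis vectors along the orbit of a point. -/
def orbitVec (y : S.Tail) (v : List (Fin n)) : EllTwo (S.Tail × ℤ) :=
  EllTwo.basisVec (S.cover.wordMap v y, (v.length : ℤ))

/-- The ℤ coordinate separates words of different lengths, whose images of y may coincide; words of
equal length are separated by injectivity. -/
theorem inner_orbitVec (y : S.Tail) (u v : List (Fin n)) :
    inner ℂ (S.orbitVec y u) (S.orbitVec y v) = if u = v then 1 else 0 := by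
  rw [orbitVec, orbitVec, EllTwo.inner_basisVec, EllTwo.basisVec_apply]
  by_cases huv : u = v
  · simp [huv]
  · rw [if_neg huv, if_neg fun h => huv ?_]
    rw [Prod.ext_iff] at h
    exact S.wordMap_injective (by simpa using h.2) h.1

theorem norm_sum_orbitVec_sq (y : S.Tail) (E : Finset (List (Fin n))) (η : E → ℂ) :
    ‖∑ v : E, η v • S.orbitVec y v‖ ^ 2 = ∑ v, ‖η v‖ ^ 2 := by
  have hon : Orthonormal ℂ fun v : E => S.orbitVec y v := by
    rw [orthonormal_iff_ite]
    intro u v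
    rw [inner_orbitVec]
    exact if_congr Subtype.ext_iff.symm rfl rfl
  have h := hon.inner_sum η η Finset.univ
  rw [inner_self_eq_norm_sq_to_K] at h
  have : ((‖∑ v : E, η v • S.orbitVec y v‖ ^ 2 : ℝ) : ℂ) = ((∑ v, ‖η v‖ ^ 2 : ℝ) : ℂ) := by
    push_cast
    refine h.trans (Finset.sum_congr rfl fun v _ => ?_)
    exact Complex.conj_mul' _
  exact_mod_cast this

theorem regularRep_eval_orbitVec (a : S.cover.CovAlg) (y : S.Tail) (v : List (Fin n)) :
    S.regularRep.eval a (S.orbitVec y v) = a.sum fun w f =>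
      S.cover.pull v f y • S.orbitVec y (w ++ v) := by
  rw [orbitVec, regularRep_eval_basisVec]
  refine Finset.sum_congr rfl fun w _ => ?_
  simp only [pull_apply, orbitVec, wordMap_append, List.length_append]
  congr 3
  push_cast
  ring

/-- The matrix entry of `a` in the Fock representation. -/
def fockEntry (a : S.cover.CovAlg) (u v : List (Fin n)) : C₀(S.Tail, ℂ) :=
  ∑ w ∈ a.support, if u = w ++ v then S.cover.pull v (a w) else 0

theorem fockEntry_apply (a : S.cover.CovAlg) (u v : List (Fin n)) (y : S.Tail) :
    S.fockEntry a u v y = inner ℂ (S.orbitVec y u) (S.regularRep.eval a (S.orbitVec y v)) := by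
  rw [fockEntry, regularRep_eval_orbitVec, c0_sum_apply, Finsupp.sum, inner_sum]
  refine Finset.sum_congr rfl fun w _ => ?_
  rw [inner_smul_right, inner_orbitVec]
  split_ifs <;> simp

/-- The scalar matrix at y is the compression of the regular representation to the span of the
orthonormal orbit vectors of y indexed by E. -/
theorem norm_fockMatrix_le {m : ℕ} (a : Matrix (Fin m) (Fin m) S.cover.CovAlg)
    (E : Finset (List (Fin n))) (y : S.Tail) :
    ‖(Matrix.of fun p q : Fin m × E => S.fockEntry (a p.1 q.1) p.2 q.2 y :
      Matrix (Fin m × E) (Fin m × E) ℂ)‖ ≤ ‖S.regularRep.evalMatrix a‖ := by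
  refine matrix_norm_le_of_sum_le _ (norm_nonneg _) fun η ξ => ?_
  let h : (Fin m × E → ℂ) → PiLp 2 fun _ : Fin m => EllTwo (S.Tail × ℤ) := fun ζ =>
    WithLp.toLp 2 fun j => ∑ v : E, ζ (j, v) • S.orbitVec y v
  have hn : ∀ ζ, ‖h ζ‖ = √(∑ q, ‖ζ q‖ ^ 2) := by
    intro ζ
    rw [norm_toLp_two, Fintype.sum_prod_type]
    congr 1
    refine Finset.sum_congr rfl fun j _ => ?_
    exact S.norm_sum_orbitVec_sq y E fun v => ζ (j, v)
  have hin : ∑ p, ∑ q, star (ξ p) * (S.fockEntry (a p.1 q.1) p.2 q.2 y * η q) =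
      inner ℂ (h ξ) (S.regularRep.evalMatrix a (h η)) := by
    rw [RowRep.inner_evalMatrix]
    simp only [h, map_sum, map_smul, sum_inner, inner_sum, inner_smul_left, inner_smul_right,
      Fintype.sum_prod_type, fockEntry_apply]
    refine Finset.sum_congr rfl fun i _ => ?_
    rw [Finset.sum_comm]
    refine Finset.sum_congr rfl fun j _ => ?_
    rw [Finset.sum_comm]
    refine Finset.sum_congr rfl fun v _ => ?_
    rw [Finset.mul_sum]
    refine Finset.sum_congr rfl fun u _ => ?_
    simp only [Complex.star_def]
    ring
  simp only [Matrix.of_apply]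
  rw [hin, ← hn, ← hn]
  calc _ ≤ ‖h ξ‖ * ‖S.regularRep.evalMatrix a (h η)‖ := norm_inner_le_norm _ _
    _ ≤ ‖h ξ‖ * (‖S.regularRep.evalMatrix a‖ * ‖h η‖) := by
      gcongr
      exact ContinuousLinearMap.le_opNorm _ _
    _ = _ := by ring

end MultiSystem

/-! ### Complete isometry of the regular representation -/

namespace RowRep

variable {n : ℕ} {X : Type u} [TopologicalSpace X] [T2Space X] {S : MultiSystem n X}
  {H : Type u} [NormedAddCommGroup H] [InnerProductSpace ℂ H] [CompleteSpace H]
  (ρ : RowRep S.cover H)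

/-- The left side is a matrix coefficient of the Fock operator of a with coefficients in π, so the
pointwise bound on the Fock matrices controls it. The bound must not depend on N, which is later
sent to infinity. -/
theorem norm_fock_sum_le {m : ℕ} (a : Matrix (Fin m) (Fin m) S.cover.CovAlg)
    (N : ℕ) (x z : Fin m → List (Fin n) → H) {cx cz : ℝ}
    (hx : ∀ M, ∑ j, ∑ v ∈ wordsLT n M, ‖x j v‖ ^ 2 ≤ cx ^ 2)
    (hz : ∀ M, ∑ j, ∑ v ∈ wordsLT n M, ‖z j v‖ ^ 2 ≤ cz ^ 2) (hcx : 0 ≤ cx) (hcz : 0 ≤ cz) :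
    ‖∑ i, ∑ j, ∑ w ∈ (a i j).support, ∑ v ∈ wordsLT n N,
      inner ℂ (z i (w ++ v)) (ρ.π (S.cover.pull v (a i j w)) (x j v))‖ ≤
      ‖S.regularRep.evalMatrix a‖ * cx * cz := by
  classical
  obtain ⟨M, hM⟩ : ∃ M, ∀ i j, ∀ w ∈ (a i j).support, w.length ≤ M := by
    refine ⟨∑ i, ∑ j, ∑ w ∈ (a i j).support, w.length, fun i j w hw => ?_⟩
    refine (Finset.single_le_sum (f := fun w : List (Fin n) => w.length)
      (fun _ _ => Nat.zero_le _) hw).trans ?_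
    refine (Finset.single_le_sum (f := fun j => ∑ w ∈ (a i j).support, w.length)
      (fun _ _ => Nat.zero_le _) (Finset.mem_univ j)).trans ?_
    exact Finset.single_le_sum (f := fun i => ∑ j, ∑ w ∈ (a i j).support, w.length)
      (fun _ _ => Nat.zero_le _) (Finset.mem_univ i)
  -- Only x is truncated at length N. Words w in the support of a have length at most M, so every w
  -- ++ v with |v| < N is still in E.
  let E := wordsLT n (M + N)
  let x' : Fin m × E → H := fun q => if (q.2 : List (Fin n)) ∈ wordsLT n N then x q.1 q.2 else 0
  let z' : Fin m × E → H := fun p => z p.1 p.2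
  have key := norm_sum_inner_le_of_matrix_norm_le ρ.π
    (fun p q : Fin m × E => S.fockEntry (a p.1 q.1) p.2 q.2) (norm_nonneg _)
    (S.norm_fockMatrix_le a E) x' z'
  have hx' : √(∑ q, ‖x' q‖ ^ 2) ≤ cx := by
    refine Real.sqrt_le_iff.2 ⟨hcx, le_trans ?_ (hx (M + N))⟩
    rw [Fintype.sum_prod_type]
    refine Finset.sum_le_sum fun j _ => ?_
    refine le_trans (Finset.sum_le_sum fun v _ => ?_)
      (Finset.sum_coe_sort E fun v => ‖x j v‖ ^ 2).le
    simp only [x']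
    split_ifs
    · exact le_rfl
    · simp
  have hz' : √(∑ q, ‖z' q‖ ^ 2) ≤ cz := by
    refine Real.sqrt_le_iff.2 ⟨hcz, le_trans (le_of_eq ?_) (hz (M + N))⟩
    rw [Fintype.sum_prod_type]
    refine Finset.sum_congr rfl fun j _ => ?_
    exact Finset.sum_coe_sort E fun v => ‖z j v‖ ^ 2
  have hsum : ∑ i, ∑ j, ∑ w ∈ (a i j).support, ∑ v ∈ wordsLT n N,
      inner ℂ (z i (w ++ v)) (ρ.π (S.cover.pull v (a i j w)) (x j v)) =
      ∑ p, ∑ q, inner ℂ (z' p) (ρ.π (S.fockEntry (a p.1 q.1) p.2 q.2) (x' q)) := by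
    simp only [Fintype.sum_prod_type]
    refine Finset.sum_congr rfl fun i _ => ?_
    conv_rhs => rw [Finset.sum_comm]
    refine Finset.sum_congr rfl fun j _ => ?_
    simp only [MultiSystem.fockEntry, map_sum, sum_apply, inner_sum, x', z']
    have hE : ∀ F : List (Fin n) → List (Fin n) → ℂ,
        ∑ u : E, ∑ v : E, F u v = ∑ u ∈ E, ∑ v ∈ E, F u v := fun F => by
      rw [← Finset.sum_coe_sort E]
      exact Finset.sum_congr rfl fun u _ => Finset.sum_coe_sort E (F u)
    refine Eq.trans ?_ (hE fun u v => ∑ w ∈ (a i j).support, inner ℂ (z i u)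
      (ρ.π (if u = w ++ v then S.cover.pull v (a i j w) else 0)
        (if v ∈ wordsLT n N then x j v else 0))).symm
    have hsub : wordsLT n N ⊆ E := fun v hv => by
      simp only [E, mem_wordsLT] at hv ⊢
      omega
    have hterm : ∀ v ∈ E, ∀ w ∈ (a i j).support, ∑ u ∈ E, inner ℂ (z i u)
        (ρ.π (if u = w ++ v then S.cover.pull v (a i j w) else 0)
          (if v ∈ wordsLT n N then x j v else 0)) =
        if v ∈ wordsLT n N then
          inner ℂ (z i (w ++ v)) (ρ.π (S.cover.pull v (a i j w)) (x j v)) else 0 := by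
      intro v _ w hw
      split_ifs with hvN
      · rw [Finset.sum_eq_single (w ++ v)]
        · rw [if_pos rfl]
        · intro u _ hu
          rw [if_neg hu]
          simp
        · intro hnot
          refine absurd ?_ hnot
          have := hM i j w hw
          simp only [E, mem_wordsLT, List.length_append] at hvN ⊢
          omega
      · simp
    rw [Finset.sum_comm (s := E) (t := E)]
    have : ∀ v ∈ E, ∑ u ∈ E, ∑ w ∈ (a i j).support, inner ℂ (z i u)
        (ρ.π (if u = w ++ v then S.cover.pull v (a i j w) else 0)
          (if v ∈ wordsLT n N then x j v else 0)) = ∑ w ∈ (a i j).support,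
        if v ∈ wordsLT n N then
          inner ℂ (z i (w ++ v)) (ρ.π (S.cover.pull v (a i j w)) (x j v)) else 0 := by
      intro v hv
      rw [Finset.sum_comm]
      exact Finset.sum_congr rfl (hterm v hv)
    rw [Finset.sum_congr rfl this]
    conv_rhs => rw [Finset.sum_comm]
    refine Finset.sum_congr rfl fun w _ => ?_
    rw [← Finset.sum_filter, Finset.filter_mem_eq_inter, Finset.inter_eq_right.2 hsub]
  rw [hsum]
  refine key.trans ?_
  gcongr

/-- Insert the Poisson kernels of x and z into the Fock estimate and let N → ∞; the intertwining
relations turn the limit into the coefficient with T_w replaced by r^{|w|} T_w. -/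
theorem norm_sum_scaled_le {m : ℕ} (a : Matrix (Fin m) (Fin m) S.cover.CovAlg) {r : ℝ}
    (hr0 : 0 ≤ r) (hr1 : r < 1) (x z : Fin m → H) :
    ‖∑ i, ∑ j, ∑ w ∈ (a i j).support,
      ((r ^ w.length : ℝ) : ℂ) * inner ℂ (z i) (ρ.word w (ρ.π (a i j w) (x j)))‖ ≤
      ‖S.regularRep.evalMatrix a‖ * √(∑ j, ‖x j‖ ^ 2) * √(∑ i, ‖z i‖ ^ 2) := by
  obtain ⟨D, hD, hDD, hDπ⟩ := ρ.exists_defect r hr0 hr1.le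
  have hb : ∀ (x : Fin m → H) (M : ℕ), ∑ j, ∑ v ∈ wordsLT n M, ‖ρ.poisson r D v (x j)‖ ^ 2 ≤
      √(∑ j, ‖x j‖ ^ 2) ^ 2 := by
    intro x M
    rw [Real.sq_sqrt (Finset.sum_nonneg fun j _ => by positivity)]
    exact Finset.sum_le_sum fun j _ => ρ.sum_norm_poisson_sq_le hD hDD M (x j)
  have hbound := fun N => ρ.norm_fock_sum_le a N (fun j v => ρ.poisson r D v (x j))
    (fun i v => ρ.poisson r D v (z i)) (hb x) (hb z) (Real.sqrt_nonneg _) (Real.sqrt_nonneg _)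
  refine le_of_tendsto' (x := Filter.atTop) (Filter.Tendsto.norm ?_) hbound
  refine tendsto_finsetSum _ fun i _ => tendsto_finsetSum _ fun j _ =>
    tendsto_finsetSum _ fun w _ => ?_
  have h := (ρ.tendsto_sum_inner_poisson hr0 hr1 hD hDD (ρ.π (a i j w) (x j))
    (star (ρ.word w) (z i))).const_mul ((r ^ w.length : ℝ) : ℂ)
  rw [inner_apply_eq_inner_star]
  refine h.congr fun N => ?_
  rw [Finset.mul_sum]
  refine Finset.sum_congr rfl fun v _ => ?_
  rw [poisson_append, π_pull_poisson _ _ hDπ, inner_smul_left, Complex.conj_ofReal]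

/-- Every row contractive representation is dominated by the regular one. -/
theorem norm_evalMatrix_le_regularRep {m : ℕ} (a : Matrix (Fin m) (Fin m) S.cover.CovAlg) :
    ‖ρ.evalMatrix a‖ ≤ ‖S.regularRep.evalMatrix a‖ := by
  refine opNorm_le_of_inner_le _ (norm_nonneg _) fun x z => ?_
  have hc : Continuous fun r : ℝ => ‖∑ i, ∑ j, ∑ w ∈ (a i j).support,
      ((r ^ w.length : ℝ) : ℂ) * inner ℂ (z i) (ρ.word w (ρ.π (a i j w) (x j)))‖ := by
    fun_prop
  have h1 : ‖inner ℂ z (ρ.evalMatrix a x)‖ = ‖∑ i, ∑ j, ∑ w ∈ (a i j).support,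
      (((1 : ℝ) ^ w.length : ℝ) : ℂ) * inner ℂ (z i) (ρ.word w (ρ.π (a i j w) (x j)))‖ := by
    rw [inner_evalMatrix]
    simp [eval, Finsupp.sum, sum_apply]
  rw [h1]
  -- The scaled sums are finite, hence continuous in r, and the bound for r < 1 passes to r = 1.
  have hlim := (hc.tendsto 1).mono_left (nhdsWithin_le_nhds (s := Set.Iio 1))
  refine le_of_tendsto hlim ?_
  have hev : ∀ᶠ r : ℝ in nhdsWithin 1 (Set.Iio 1), 0 ≤ r ∧ r < 1 := by
    have h0 : ∀ᶠ r : ℝ in nhdsWithin 1 (Set.Iio 1), 0 ≤ r :=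
      nhdsWithin_le_nhds (eventually_ge_nhds one_pos)
    exact h0.and self_mem_nhdsWithin
  filter_upwards [hev] with r hr
  have := ρ.norm_sum_scaled_le a hr.1 hr.2 x z
  rwa [← PiLp.norm_eq_of_L2, ← PiLp.norm_eq_of_L2] at this

theorem regularRep_isCompletelyIsometric : S.regularRep.IsCompletelyIsometric := by
  intro m a
  refine IsGreatest.csSup_eq (s := {r | ∃ (H : Type u) (_ : NormedAddCommGroup H)
    (_ : InnerProductSpace ℂ H) (_ : CompleteSpace H) (ρ : RowRep S.cover H),
    r = ‖ρ.evalMatrix a‖}) ⟨⟨_, _, _, inferInstance, S.regularRep, rfl⟩, ?_⟩ |>.symm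
  rintro r ⟨K, i1, i2, i3, ρ, rfl⟩
  exact ρ.norm_evalMatrix_le_regularRep a

end RowRep

end

noncomputable section

namespace RowRep

variable {n : ℕ} {X : Type u} [TopologicalSpace X] [T2Space X] {S : MultiSystem n X}
  {H : Type u} [NormedAddCommGroup H] [InnerProductSpace ℂ H] [CompleteSpace H]

/-- The Cuntz relations, relative to the range of `π`, and faithfulness of `π`. -/
structure IsCuntz (ρ : RowRep S.cover H) : Prop where
  star_T_mul_T_mul_π : ∀ i j f, star (ρ.T i) * ρ.T j * ρ.π f = if i = j then ρ.π f else 0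
  sum_T_mul_star_T_mul_π : ∀ f, ∑ i, ρ.T i * star (ρ.T i) * ρ.π f = ρ.π f
  norm_le_norm_π : ∀ f, ‖f‖ ≤ ‖ρ.π f‖

/-! ### The C*-envelope satisfies the Cuntz relations -/

section Envelope

variable (ρ : RowRep S.cover H)

theorem eval_single (w : List (Fin n)) (f : C₀(S.Tail, ℂ)) :
    ρ.eval (Finsupp.single w f) = ρ.word w * ρ.π f := by
  rw [eval, Finsupp.sum_single_index]
  rw [map_zero, mul_zero]

theorem star_T_mul_π (i : Fin n) (f : C₀(S.Tail, ℂ)) :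
    star (ρ.T i) * ρ.π f = ρ.π (S.cover.pullback i f) * star (ρ.T i) := by
  have := ρ.star_word_mul_π [i] f
  rwa [word_singleton] at this

theorem π_shiftPull_mul_T (i : Fin n) (f : C₀(S.Tail, ℂ)) :
    ρ.π (S.shiftPull f) * ρ.T i = ρ.T i * ρ.π f := by
  rw [ρ.covariant, S.pullback_shiftPull]

/-- Special to the cover: every f is (f ∘ τ) ∘ σ̃_i for all i at once, so f moves through both
factors. -/
theorem commute_π_star_T_mul_T (i j : Fin n) (f : C₀(S.Tail, ℂ)) :
    Commute (ρ.π f) (star (ρ.T i) * ρ.T j) := by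
  have h := ρ.star_T_mul_π i (S.shiftPull f)
  rw [S.pullback_shiftPull] at h
  rw [commute_iff_eq, ← mul_assoc, ← h, mul_assoc, π_shiftPull_mul_T, mul_assoc]

theorem commute_π_T_mul_star_T (i : Fin n) (f : C₀(S.Tail, ℂ)) :
    Commute (ρ.π f) (ρ.T i * star (ρ.T i)) := by
  rw [commute_iff_eq, ← mul_assoc, ρ.covariant, mul_assoc, ← star_T_mul_π, mul_assoc]

/-- An operator commuting with the range of `π` vanishes on it if it vanishes on products. -/
theorem mul_π_eq_zero {D : H →L[ℂ] H} (hD : ∀ f, Commute (ρ.π f) D)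
    (h : ∀ f g, ρ.π f * D * ρ.π g = 0) (f : C₀(S.Tail, ℂ)) : D * ρ.π f = 0 := by
  rw [← CStarRing.mul_star_self_eq_zero_iff, star_mul, ← map_star]
  calc D * ρ.π f * (ρ.π (star f) * star D) = D * ρ.π f * ρ.π (star f) * star D := by
        rw [mul_assoc, mul_assoc, mul_assoc]
    _ = 0 := by rw [← (hD f).eq, h, zero_mul]

theorem norm_evalMatrix_one_le (f : C₀(S.Tail, ℂ)) :
    ‖ρ.evalMatrix (Matrix.of fun _ _ : Fin 1 => Finsupp.single [] f)‖ ≤ ‖ρ.π f‖ := by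
  refine opNorm_le_of_inner_le _ (norm_nonneg _) fun x z => ?_
  rw [inner_evalMatrix]
  simp only [Finset.univ_unique, Finset.sum_singleton, Matrix.of_apply, eval_single,
    word_nil, one_mul]
  refine (norm_inner_le_norm _ _).trans ?_
  have h1 := (ρ.π f).le_opNorm (x default)
  have h2 := PiLp.norm_apply_le x default
  have h3 := PiLp.norm_apply_le z default
  calc _ ≤ ‖z‖ * (‖ρ.π f‖ * ‖x‖) := by
        gcongr
        exact h1.trans (by gcongr)
    _ = _ := by ring

theorem norm_apply_le_norm_evalMatrix_regularRep (f : C₀(S.Tail, ℂ)) (y : S.Tail) :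
    ‖f y‖ ≤ ‖S.regularRep.evalMatrix (Matrix.of fun _ _ : Fin 1 => Finsupp.single [] f)‖ := by
  set v : PiLp 2 fun _ : Fin 1 => EllTwo (S.Tail × ℤ) :=
    WithLp.toLp 2 fun _ => S.orbitVec y [] with hv
  have hb : ‖S.orbitVec y []‖ ^ 2 = 1 := by
    have h := S.inner_orbitVec y [] []
    rw [inner_self_eq_norm_sq_to_K, if_pos rfl] at h
    exact Complex.ofReal_injective (by push_cast; exact h)
  have hn : ‖v‖ = 1 := by
    rw [hv, norm_toLp_two]
    simp [hb]
  have hin : inner ℂ v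
      (S.regularRep.evalMatrix (Matrix.of fun _ _ : Fin 1 => Finsupp.single [] f) v) =
      f y := by
    rw [inner_evalMatrix]
    simp only [Finset.univ_unique, Finset.sum_singleton, Matrix.of_apply, hv,
      S.regularRep_eval_orbitVec]
    rw [Finsupp.sum_single_index (by simp [S.cover.pull_apply]), inner_smul_right,
      List.append_nil, S.inner_orbitVec, if_pos rfl, mul_one]
    rfl
  have := (norm_inner_le_norm (𝕜 := ℂ) v _).trans
    (mul_le_mul_of_nonneg_left ((S.regularRep.evalMatrix (Matrix.of fun _ _ : Fin 1 =>
      Finsupp.single [] f)).le_opNorm v) (norm_nonneg v))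
  rwa [hin, hn, one_mul, mul_one] at this

variable {ρ}

theorem IsCompletelyIsometric.norm_le_norm_π (hρ : ρ.IsCompletelyIsometric)
    (f : C₀(S.Tail, ℂ)) : ‖f‖ ≤ ‖ρ.π f‖ := by
  refine (c0_norm_le f (norm_nonneg _)).2 fun y => ?_
  refine (norm_apply_le_norm_evalMatrix_regularRep f y).trans ?_
  rw [regularRep_isCompletelyIsometric, ← hρ]
  exact ρ.norm_evalMatrix_one_le f

/-- The universal property gives a `*`-homomorphism from the C*-algebra of the regular
representation. The t_i themselves need not lie in that algebra, so the relations are transported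
between functions and `mul_π_eq_zero` then removes the left one. -/
theorem IsCStarEnvelope.isCuntz (hρ : ρ.IsCStarEnvelope) : ρ.IsCuntz := by
  obtain ⟨q, -, hq⟩ := hρ.2 _ S.regularRep regularRep_isCompletelyIsometric
  let A : List (Fin n) → C₀(S.Tail, ℂ) → S.regularRep.cstar := fun w f =>
    ⟨S.regularRep.eval (Finsupp.single w f), S.regularRep.eval_mem_cstar _⟩
  let R := NonUnitalStarSubalgebraClass.subtype S.regularRep.cstar
  let Q := (NonUnitalStarSubalgebraClass.subtype ρ.cstar).comp q
  have hR : Function.Injective R := Subtype.val_injective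
  have hA : ∀ w f, R (A w f) = S.regularRep.word w * S.regularRep.π f :=
    fun w f => S.regularRep.eval_single w f
  have hQ : ∀ w f, Q (A w f) = ρ.word w * ρ.π f := fun w f =>
    (congrArg Subtype.val (hq (Finsupp.single w f))).trans (ρ.eval_single w f)
  have hiso : ∀ i j, star (S.regularRep.T i) * S.regularRep.T j = if i = j then 1 else 0 :=
    S.star_regularT_mul_regularT
  have hco : ∑ i, S.regularRep.T i * star (S.regularRep.T i) = 1 := S.sum_regularT_mul_star
  refine ⟨fun i j f => ?_, fun f => ?_, hρ.1.norm_le_norm_π⟩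
  · have h1 : ∀ f g, star (A [i] f) * A [j] g = if i = j then A [] (star f * g) else 0 := by
      intro f g
      apply hR
      rw [map_mul, map_star, hA, hA, word_singleton, word_singleton, star_mul,
        mul_assoc (star _), ← mul_assoc (star (S.regularRep.T i)), hiso]
      split_ifs
      · rw [one_mul, hA, word_nil, one_mul, map_mul, map_star]
      · simp
    have h2 : ∀ f g, ρ.π (star f) * (star (ρ.T i) * ρ.T j) * ρ.π g =
        if i = j then ρ.π (star f) * ρ.π g else 0 := by
      intro f g
      have h := congrArg Q (h1 f g)
      rw [map_mul, map_star, hQ, hQ, word_singleton, word_singleton, star_mul] at h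
      rw [map_star]
      calc _ = star (ρ.π f) * star (ρ.T i) * (ρ.T j * ρ.π g) := by simp only [mul_assoc]
        _ = _ := by
          rw [h]
          split_ifs
          · rw [hQ, word_nil, one_mul, map_mul, map_star]
          · simp
    have h3 := ρ.mul_π_eq_zero (D := star (ρ.T i) * ρ.T j - if i = j then 1 else 0)
      (fun f => (ρ.commute_π_star_T_mul_T i j f).sub_right (by split_ifs <;> simp)) (fun f g => by
        have := h2 (star f) g
        rw [star_star] at this
        rw [mul_sub, sub_mul, this]
        split_ifs <;> simp) f
    rw [sub_mul, sub_eq_zero] at h3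
    rw [h3]
    split_ifs <;> simp
  -- Since t_i (f ∘ σ̃_i) = f t_i, this is f (∑ t_i t_i^*) g^* written with elements t_w f of the
  -- algebra.
  · have h1 : ∀ f g, ∑ i, A [i] (S.cover.pullback i f) * star (A [i] (S.cover.pullback i g)) =
        A [] (f * star g) := by
      intro f g
      apply hR
      rw [map_sum]
      simp only [map_mul R, map_star R, hA, word_singleton, ← S.regularRep.covariant, star_mul]
      calc _ = ∑ i, S.regularRep.π f * (S.regularRep.T i * star (S.regularRep.T i)) *
            star (S.regularRep.π g) := by simp only [mul_assoc]
        _ = _ := by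
          rw [← Finset.sum_mul, ← Finset.mul_sum, hco, mul_one, word_nil, one_mul, map_mul,
            map_star]
    have h2 : ∀ f g, ρ.π f * (∑ i, ρ.T i * star (ρ.T i)) * ρ.π (star g) =
        ρ.π f * ρ.π (star g) := by
      intro f g
      have h := congrArg Q (h1 f g)
      simp only [map_sum Q, map_mul Q, map_star Q, hQ, word_singleton, ← ρ.covariant, star_mul,
        word_nil, one_mul, map_mul ρ.π, map_star ρ.π] at h
      rw [map_star, ← h, Finset.mul_sum, Finset.sum_mul]
      simp only [mul_assoc]
    have h3 := ρ.mul_π_eq_zero (D := ∑ i, ρ.T i * star (ρ.T i) - 1)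
      (fun f => (Commute.sum_right _ _ _ fun i _ => ρ.commute_π_T_mul_star_T i f).sub_right
        (Commute.one_right _)) (fun f g => by
        have := h2 f (star g)
        rw [star_star] at this
        rw [mul_sub, sub_mul, this, mul_one, sub_self]) f
    rw [sub_mul, sub_eq_zero, one_mul, Finset.sum_mul] at h3
    exact h3

end Envelope

/-! ### Matrix units over `C₀(X̃)` -/

/-- The element `𝔱_u f 𝔱_v^*`. -/
def unit (ρ : RowRep S.cover H) (u : List (Fin n)) (f : C₀(S.Tail, ℂ)) (v : List (Fin n)) :
    H →L[ℂ] H := ρ.word u * ρ.π f * star (ρ.word v)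

section Units

variable (ρ : RowRep S.cover H)

theorem unit_nil (f : C₀(S.Tail, ℂ)) : ρ.unit [] f [] = ρ.π f := by
  simp [unit, word_nil]

theorem unit_add (u v : List (Fin n)) (f g : C₀(S.Tail, ℂ)) :
    ρ.unit u (f + g) v = ρ.unit u f v + ρ.unit u g v := by
  simp [unit, mul_add, add_mul]

theorem unit_sub (u v : List (Fin n)) (f g : C₀(S.Tail, ℂ)) :
    ρ.unit u (f - g) v = ρ.unit u f v - ρ.unit u g v := by
  simp [unit, mul_sub, sub_mul]

theorem unit_smul (u v : List (Fin n)) (c : ℂ) (f : C₀(S.Tail, ℂ)) :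
    ρ.unit u (c • f) v = c • ρ.unit u f v := by
  simp [unit]

theorem unit_zero (u v : List (Fin n)) : ρ.unit u 0 v = 0 := by
  simp [unit]

theorem unit_sum {ι : Type*} (t : Finset ι) (u v : List (Fin n)) (f : ι → C₀(S.Tail, ℂ)) :
    ρ.unit u (∑ s ∈ t, f s) v = ∑ s ∈ t, ρ.unit u (f s) v := by
  simp [unit, Finset.mul_sum, Finset.sum_mul]

theorem star_unit (u v : List (Fin n)) (f : C₀(S.Tail, ℂ)) :
    star (ρ.unit u f v) = ρ.unit v (star f) u := by
  simp [unit, mul_assoc, map_star]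

theorem T_mul_unit_mul_star_T (i j : Fin n) (u v : List (Fin n)) (f : C₀(S.Tail, ℂ)) :
    ρ.T i * ρ.unit u f v * star (ρ.T j) = ρ.unit (i :: u) f (j :: v) := by
  simp only [unit, word_cons, star_mul, mul_assoc]

theorem norm_π_le (f : C₀(S.Tail, ℂ)) : ‖ρ.π f‖ ≤ ‖f‖ := NonUnitalStarAlgHom.norm_apply_le ρ.π f

theorem norm_word_le (w : List (Fin n)) : ‖ρ.word w‖ ≤ 1 := by
  rw [← norm_star]
  refine ContinuousLinearMap.opNorm_le_bound _ zero_le_one fun h => ?_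
  rw [one_mul]
  refine le_of_sq_le_sq ?_ (norm_nonneg h)
  exact (Finset.single_le_sum (f := fun w => ‖star (ρ.word w) h‖ ^ 2)
    (fun _ _ => by positivity) (mem_words.2 rfl)).trans (ρ.sum_norm_star_word_sq_le w.length h)

theorem norm_unit_le (u v : List (Fin n)) (f : C₀(S.Tail, ℂ)) : ‖ρ.unit u f v‖ ≤ ‖f‖ := by
  calc _ ≤ ‖ρ.word u * ρ.π f‖ * ‖star (ρ.word v)‖ := norm_mul_le _ _
    _ ≤ ‖ρ.word u‖ * ‖ρ.π f‖ * ‖star (ρ.word v)‖ := by gcongr; exact norm_mul_le _ _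
    _ ≤ 1 * ‖f‖ * 1 := by
      gcongr
      · exact ρ.norm_word_le u
      · exact ρ.norm_π_le f
      · rw [norm_star]; exact ρ.norm_word_le v
    _ = ‖f‖ := by ring

open scoped Matrix.Norms.L2Operator in
-- The row of all t_u with |u| = k is a contraction, so the sum is a contractive compression of the
-- amplified matrix g.
theorem norm_sum_unit_le (k : ℕ) (g : words n k → words n k → C₀(S.Tail, ℂ)) {c : ℝ} (hc : 0 ≤ c)
    (hg : ∀ y, ‖(Matrix.of fun u v => g u v y : Matrix (words n k) (words n k) ℂ)‖ ≤ c) :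
    ‖∑ u : words n k, ∑ v : words n k, ρ.unit u (g u v) v‖ ≤ c := by
  refine opNorm_le_of_inner_le _ hc fun x z => ?_
  have hb : ∀ h : H, √(∑ u : words n k, ‖star (ρ.word u) h‖ ^ 2) ≤ ‖h‖ := fun h => by
    rw [Finset.sum_coe_sort (words n k) fun u => ‖star (ρ.word u) h‖ ^ 2]
    exact Real.sqrt_le_iff.2 ⟨norm_nonneg h, ρ.sum_norm_star_word_sq_le k h⟩
  have := norm_sum_inner_le_of_matrix_norm_le ρ.π g hc hg (fun v => star (ρ.word v) x)
    (fun u => star (ρ.word u) z)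
  simp only [← inner_apply_eq_inner_star] at this
  simp only [sum_apply, inner_sum, unit, mul_apply_eq_comp]
  refine this.trans ?_
  gcongr
  · exact hb x
  · exact hb z

theorem norm_row_le (k : ℕ) (u : List (Fin n)) (e : C₀(S.Tail, ℂ)) (he : ‖e‖ ≤ 1)
    (ξ : words n k → ℂ) : ‖∑ p, star (ξ p) • ρ.unit u e p‖ ≤ √(∑ p, ‖ξ p‖ ^ 2) := by
  have heq : ∑ p, star (ξ p) • ρ.unit u e p =
      ρ.word u * ρ.π e * ∑ p, star (ξ p) • star (ρ.word p) := by
    simp [unit, Finset.mul_sum]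
  have h1 : ‖∑ p, star (ξ p) • star (ρ.word p)‖ ≤ √(∑ p, ‖ξ p‖ ^ 2) := by
    refine ContinuousLinearMap.opNorm_le_bound _ (Real.sqrt_nonneg _) fun h => ?_
    rw [sum_apply]
    refine (norm_sum_le _ _).trans ?_
    simp only [smul_apply, norm_smul, norm_star]
    refine (Real.sum_mul_le_sqrt_mul_sqrt _ _ _).trans ?_
    gcongr
    rw [Finset.sum_coe_sort (words n k) fun u => ‖star (ρ.word u) h‖ ^ 2]
    exact Real.sqrt_le_iff.2 ⟨norm_nonneg h, ρ.sum_norm_star_word_sq_le k h⟩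
  rw [heq]
  calc _ ≤ ‖ρ.word u * ρ.π e‖ * ‖∑ p, star (ξ p) • star (ρ.word p)‖ := norm_mul_le _ _
    _ ≤ ‖ρ.word u‖ * ‖ρ.π e‖ * ‖∑ p, star (ξ p) • star (ρ.word p)‖ := by
      gcongr; exact norm_mul_le _ _
    _ ≤ 1 * 1 * √(∑ p, ‖ξ p‖ ^ 2) := by
      gcongr
      · exact ρ.norm_word_le u
      · exact (ρ.norm_π_le e).trans he
    _ = _ := by ring

/-- Take g = f ∘ τ^{|v|}. It brings a function next to t_i^* t_j, where the relative Cuntz relations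
apply. -/
theorem exists_word_mul_π_eq (v : List (Fin n)) (f : C₀(S.Tail, ℂ)) :
    ∃ g, ρ.word v * ρ.π f = ρ.π g * ρ.word v := by
  induction v with
  | nil => exact ⟨f, by simp [word_nil]⟩
  | cons i v ih =>
    obtain ⟨g, hg⟩ := ih
    exact ⟨S.shiftPull g, by
      rw [word_cons, mul_assoc, hg, ← mul_assoc, ← mul_assoc, π_shiftPull_mul_T]⟩

variable {ρ} (hρ : ρ.IsCuntz)
include hρ

theorem IsCuntz.star_word_mul_word_mul_π {u v : List (Fin n)} (huv : u.length = v.length)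
    (f : C₀(S.Tail, ℂ)) :
    star (ρ.word u) * ρ.word v * ρ.π f = if u = v then ρ.π f else 0 := by
  induction u generalizing v with
  | nil =>
    obtain rfl := List.length_eq_zero_iff.1 huv.symm
    simp [word_nil]
  | cons i u ih =>
    cases v with
    | nil => simp at huv
    | cons j v =>
      obtain ⟨g, hg⟩ := ρ.exists_word_mul_π_eq v f
      calc star (ρ.word (i :: u)) * ρ.word (j :: v) * ρ.π f
          = star (ρ.word u) * (star (ρ.T i) * ρ.T j * (ρ.word v * ρ.π f)) := by
            simp only [word_cons, star_mul, mul_assoc]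
        _ = star (ρ.word u) * (star (ρ.T i) * ρ.T j * ρ.π g * ρ.word v) := by
            rw [hg, mul_assoc (_ * _) (ρ.π g)]
        _ = _ := by
            rw [hρ.star_T_mul_T_mul_π]
            by_cases hij : i = j
            · subst hij
              rw [if_pos rfl, ← hg, ← mul_assoc, ih (by simpa using huv)]
              simp
            · rw [if_neg hij, if_neg (by simp [hij]), zero_mul, mul_zero]

theorem IsCuntz.unit_mul_unit {u v u' v' : List (Fin n)} (h : v.length = u'.length)
    (f g : C₀(S.Tail, ℂ)) :
    ρ.unit u f v * ρ.unit u' g v' = if v = u' then ρ.unit u (f * g) v' else 0 := by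
  calc ρ.unit u f v * ρ.unit u' g v'
      = ρ.word u * ρ.π f * (star (ρ.word v) * ρ.word u' * ρ.π g) * star (ρ.word v') := by
        simp only [unit, mul_assoc]
    _ = _ := by
      rw [hρ.star_word_mul_word_mul_π h]
      split_ifs
      · rw [unit, map_mul, ← mul_assoc]
      · simp

theorem IsCuntz.unit_mul_π_mul_unit {u p q v : List (Fin n)} (h : p.length = q.length)
    (a f b : C₀(S.Tail, ℂ)) :
    ρ.unit u a p * ρ.π f * ρ.unit q b v =
      if p = q then ρ.unit u (a * S.cover.pull p f * b) v else 0 := by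
  have : ρ.unit u a p * ρ.π f = ρ.unit u (a * S.cover.pull p f) p := by
    rw [unit, mul_assoc, star_word_mul_π, unit, map_mul]
    simp only [mul_assoc]
  rw [this, hρ.unit_mul_unit h]

theorem IsCuntz.sum_unit_singleton (f : C₀(S.Tail, ℂ)) :
    ∑ i, ρ.unit [i] (S.cover.pullback i f) [i] = ρ.π f := by
  conv_rhs => rw [← hρ.sum_T_mul_star_T_mul_π f]
  refine Finset.sum_congr rfl fun i _ => ?_
  rw [unit, word_singleton, mul_assoc, ← star_T_mul_π, mul_assoc]

theorem IsCuntz.unit_eq_sum_unit (u v : List (Fin n)) (f : C₀(S.Tail, ℂ)) :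
    ρ.unit u f v = ∑ i, ρ.unit (u ++ [i]) (S.cover.pullback i f) (v ++ [i]) := by
  rw [unit, ← hρ.sum_unit_singleton f, Finset.mul_sum, Finset.sum_mul]
  refine Finset.sum_congr rfl fun i _ => ?_
  simp only [unit, word_append, star_mul, mul_assoc]

/-- In g = ∑ t_j (g ∘ σ̃_j) t_j^*, a function g supported on the range of σ̃_i has only the term j =
i. Thus diagonal matrix units are functions, which ties 𝔅 to C₀(X̃). -/
theorem IsCuntz.unit_self_eq_π_pushWord (u : List (Fin n)) (f : C₀(S.Tail, ℂ)) :
    ρ.unit u f u = ρ.π (S.pushWord u f) := by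
  induction u with
  | nil => exact ρ.unit_nil f
  | cons i u ih =>
    rw [← T_mul_unit_mul_star_T, ih, MultiSystem.pushWord,
      ← hρ.sum_unit_singleton (S.push i _),
      Finset.sum_eq_single i]
    · rw [S.pullback_push, if_pos rfl, unit, word_singleton]
    · intro j _ hj
      rw [S.pullback_push, if_neg hj, unit_zero]
    · simp

end Units

end RowRep

end

noncomputable section

/-- `I_F` as a subspace of `C₀(Y)`. -/
def vanishingSubmodule {Y : Type u} [TopologicalSpace Y] (F : Set Y) : Submodule ℂ C₀(Y, ℂ) where
  carrier := vanishingIdeal F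
  zero_mem' _ _ := rfl
  add_mem' hf hg x hx := by
    rw [ZeroAtInftyContinuousMap.add_apply, hf x hx, hg x hx, add_zero]
  smul_mem' c f hf x hx := by
    rw [ZeroAtInftyContinuousMap.smul_apply, hf x hx, smul_zero]

namespace RowRep

variable {n : ℕ} {X : Type u} [TopologicalSpace X] [T2Space X] {S : MultiSystem n X}
  {H : Type u} [NormedAddCommGroup H] [InnerProductSpace ℂ H] [CompleteSpace H]

/-! ### The filtration of the core -/

section Level

variable (ρ : RowRep S.cover H)

/-- The span of the elements `𝔱_u f 𝔱_v^*` with `|u| = |v| = k` and `f ∈ I k`. -/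
def level (I : ℕ → Submodule ℂ C₀(S.Tail, ℂ)) (k : ℕ) : Submodule ℂ (H →L[ℂ] H) :=
  Submodule.span ℂ {b | ∃ (u v : List (Fin n)) (f : C₀(S.Tail, ℂ)), u.length = k ∧ v.length = k ∧
    f ∈ I k ∧ b = ρ.unit u f v}

variable {ρ} in
theorem unit_mem_level {I : ℕ → Submodule ℂ C₀(S.Tail, ℂ)} {k : ℕ} {u v : List (Fin n)}
    {f : C₀(S.Tail, ℂ)} (hu : u.length = k) (hv : v.length = k) (hf : f ∈ I k) :
    ρ.unit u f v ∈ ρ.level I k :=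
  Submodule.subset_span ⟨u, v, f, hu, hv, hf, rfl⟩

theorem coreAlg_eq : ρ.coreAlg = (⨆ k, ρ.level (fun _ => ⊤) k).topologicalClosure := by
  rw [coreAlg]
  congr 1
  apply le_antisymm
  · refine Submodule.span_le.2 ?_
    rintro _ ⟨u, v, f, huv, rfl⟩
    exact Submodule.mem_iSup_of_mem u.length (unit_mem_level rfl huv.symm trivial)
  · refine iSup_le fun k => Submodule.span_le.2 ?_
    rintro _ ⟨u, v, f, hu, hv, -, rfl⟩
    exact Submodule.subset_span ⟨u, v, f, hu.trans hv.symm, rfl⟩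

theorem unit_mem_coreAlg {u v : List (Fin n)} (huv : u.length = v.length) (f : C₀(S.Tail, ℂ)) :
    ρ.unit u f v ∈ ρ.coreAlg :=
  Submodule.le_topologicalClosure _ (Submodule.subset_span ⟨u, v, f, huv, rfl⟩)

theorem π_mem_coreAlg (f : C₀(S.Tail, ℂ)) : ρ.π f ∈ ρ.coreAlg := by
  rw [← unit_nil]
  exact ρ.unit_mem_coreAlg rfl f

theorem exists_eq_sum_of_mem_level {I : ℕ → Submodule ℂ C₀(S.Tail, ℂ)} {k : ℕ} {b : H →L[ℂ] H}
    (hb : b ∈ ρ.level I k) : ∃ f : words n k → words n k → C₀(S.Tail, ℂ),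
      (∀ u v, f u v ∈ I k) ∧ b = ∑ u : words n k, ∑ v : words n k, ρ.unit u (f u v) v := by
  classical
  induction hb using Submodule.span_induction with
  | mem b hb =>
    obtain ⟨u, v, f, hu, hv, hf, rfl⟩ := hb
    refine ⟨fun p q => if (p : List (Fin n)) = u ∧ (q : List (Fin n)) = v then f else 0,
      fun p q => ?_, ?_⟩
    · beta_reduce
      split_ifs
      · exact hf
      · exact zero_mem _
    · beta_reduce
      rw [Finset.sum_eq_single ⟨u, mem_words.2 hu⟩, Finset.sum_eq_single ⟨v, mem_words.2 hv⟩]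
      · rw [if_pos ⟨rfl, rfl⟩]
      · intro q _ hq
        rw [if_neg fun h => hq (Subtype.ext h.2), unit_zero]
      · simp
      · intro p _ hp
        refine Finset.sum_eq_zero fun q _ => ?_
        rw [if_neg fun h => hp (Subtype.ext h.1), unit_zero]
      · simp
  | zero => exact ⟨fun _ _ => 0, fun _ _ => zero_mem _, by simp [unit_zero]⟩
  | add x y _ _ hx hy =>
    obtain ⟨f, hf, rfl⟩ := hx
    obtain ⟨g, hg, rfl⟩ := hy
    exact ⟨fun u v => f u v + g u v, fun u v => add_mem (hf u v) (hg u v), by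
      simp only [unit_add, Finset.sum_add_distrib]⟩
  | smul c x _ hx =>
    obtain ⟨f, hf, rfl⟩ := hx
    exact ⟨fun u v => c • f u v, fun u v => Submodule.smul_mem _ c (hf u v), by
      simp only [unit_smul, Finset.smul_sum]⟩

variable {ρ} (hρ : ρ.IsCuntz)
include hρ

/-- Rewrite t_u f t_v^* as ∑ t_{ui} (f ∘ σ̃_i) t_{vi}^*. -/
theorem IsCuntz.monotone_level {I : ℕ → Submodule ℂ C₀(S.Tail, ℂ)}
    (hI : ∀ k, ∀ f ∈ I k, ∀ i, S.cover.pullback i f ∈ I (k + 1)) : Monotone (ρ.level I) := by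
  refine monotone_nat_of_le_succ fun k => Submodule.span_le.2 ?_
  rintro _ ⟨u, v, f, hu, hv, hf, rfl⟩
  rw [hρ.unit_eq_sum_unit]
  exact Submodule.sum_mem _ fun i _ =>
    unit_mem_level (by simp [hu]) (by simp [hv]) (hI k f hf i)

theorem IsCuntz.exists_mem_level {I : ℕ → Submodule ℂ C₀(S.Tail, ℂ)}
    (hI : ∀ k, ∀ f ∈ I k, ∀ i, S.cover.pullback i f ∈ I (k + 1)) {b : H →L[ℂ] H}
    (hb : b ∈ ⨆ k, ρ.level I k) : ∃ k, b ∈ ρ.level I k :=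
  (Submodule.mem_iSup_of_chain ⟨ρ.level I, hρ.monotone_level hI⟩ b).1 hb

theorem IsCuntz.unit_mul_sum_mul_unit {k : ℕ} (f : words n k → words n k → C₀(S.Tail, ℂ))
    (u v : List (Fin n)) (p q : words n k) (a b : C₀(S.Tail, ℂ)) :
    ρ.unit u a p * (∑ s : words n k, ∑ t : words n k, ρ.unit s (f s t) t) * ρ.unit q b v =
      ρ.unit u (a * f p q * b) v := by
  have hl : ∀ s t : words n k, (s : List (Fin n)).length = (t : List (Fin n)).length :=
    fun s t => (mem_words.1 s.2).trans (mem_words.1 t.2).symm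
  rw [Finset.mul_sum, Finset.sum_mul, Finset.sum_eq_single p, Finset.mul_sum, Finset.sum_mul,
    Finset.sum_eq_single q]
  · rw [hρ.unit_mul_unit rfl, if_pos rfl, hρ.unit_mul_unit rfl, if_pos rfl]
  · intro t _ ht
    rw [hρ.unit_mul_unit rfl, if_pos rfl, hρ.unit_mul_unit (hl t q),
      if_neg fun h => ht (Subtype.ext h)]
  · simp
  · intro s _ hs
    rw [Finset.mul_sum, Finset.sum_mul]
    refine Finset.sum_eq_zero fun t _ => ?_
    rw [hρ.unit_mul_unit (hl p s), if_neg fun h => hs (Subtype.ext h.symm), zero_mul]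
  · simp

theorem IsCuntz.mul_mem_level {I I' I'' : ℕ → Submodule ℂ C₀(S.Tail, ℂ)} {k : ℕ}
    (h : ∀ f ∈ I k, ∀ g ∈ I' k, f * g ∈ I'' k) {a b : H →L[ℂ] H} (ha : a ∈ ρ.level I k)
    (hb : b ∈ ρ.level I' k) : a * b ∈ ρ.level I'' k := by
  have hle : ρ.level I k * ρ.level I' k ≤ ρ.level I'' k := by
    rw [level, level, Submodule.span_mul_span]
    refine Submodule.span_le.2 ?_
    rintro _ ⟨_, ⟨u, v, f, hu, hv, hf, rfl⟩, _, ⟨u', v', g, hu', hv', hg, rfl⟩, rfl⟩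
    simp only
    rw [hρ.unit_mul_unit (hv.trans hu'.symm)]
    split_ifs
    · exact unit_mem_level hu hv' (h f hf g hg)
    · exact zero_mem _
  exact hle (Submodule.mul_mem_mul ha hb)

end Level

/-! ### From closed sets to ideals -/

section IdealOf

variable (ρ : RowRep S.cover H)

/-- The closed span of the elements `𝔱_u f 𝔱_v^*` with `|u| = |v|` and `f = 0` on `τ^{|u|}(F)`. -/
def idealOf (F : Set S.Tail) : Submodule ℂ (H →L[ℂ] H) :=
  (⨆ k, ρ.level (fun k => vanishingSubmodule (S.shift^[k] '' F)) k).topologicalClosure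

theorem endo_add (a b : H →L[ℂ] H) : ρ.endo (a + b) = ρ.endo a + ρ.endo b := by
  simp [endo, mul_add, add_mul, Finset.sum_add_distrib]

theorem endo_smul (c : ℂ) (a : H →L[ℂ] H) : ρ.endo (c • a) = c • ρ.endo a := by
  simp only [endo, mul_smul_comm, smul_mul_assoc, Finset.smul_sum, smul_comm c]

theorem continuous_endo : Continuous ρ.endo := by
  unfold endo
  fun_prop

theorem endo_unit (u v : List (Fin n)) (f : C₀(S.Tail, ℂ)) :
    ρ.endo (ρ.unit u f v) = (n : ℂ)⁻¹ • ∑ i, ∑ j, ρ.unit (i :: u) f (j :: v) := by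
  simp only [endo, T_mul_unit_mul_star_T]

/-- Robustness puts σ̃_i τ^{k+1}(x) in τ^k(F) for x ∈ F. -/
theorem pullback_mem_vanishingSubmodule {F : Set S.Tail} (hF : S.IsRobust F) (k : ℕ)
    (f : C₀(S.Tail, ℂ)) (hf : f ∈ vanishingSubmodule (S.shift^[k] '' F)) (i : Fin n) :
    S.cover.pullback i f ∈ vanishingSubmodule (S.shift^[k + 1] '' F) := by
  rintro _ ⟨x, hx, rfl⟩
  rw [MultiSystem.pullback_apply]
  -- Any prefix of length k would do, as τ^k removes it; the initial word of x is one at hand.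
  refine hf _ ⟨_, hF x hx (S.initialWord k x ++ [i]), ?_⟩
  have hl := S.length_initialWord k x
  rw [MultiSystem.wordMap_append, List.length_append, hl]
  have := S.shift_iterate_wordMap (S.initialWord k x)
    (S.cover.wordMap [i] (S.shift^[k + [i].length] x))
  rw [hl] at this
  rw [this]
  rfl

variable {ρ} (hρ : ρ.IsCuntz)
include hρ

/-- Two elements of the dense unions share a level, where products are matrix products over an ideal
of C₀(X̃). The map α raises the level by one, and τ^{k+1}(F) ⊆ τ^k(F). -/
theorem IsCuntz.isInvariantIdeal_idealOf {F : Set S.Tail} (hF : S.IsRobust F)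
    (hF' : S.IsShiftInvariant F) : ρ.IsInvariantIdeal (ρ.idealOf F) := by
  set I : ℕ → Submodule ℂ C₀(S.Tail, ℂ) := fun k => vanishingSubmodule (S.shift^[k] '' F) with hI
  have hmI := hρ.monotone_level (pullback_mem_vanishingSubmodule hF)
  have hmT := hρ.monotone_level (I := fun _ => ⊤) fun _ _ _ _ => trivial
  have hlev : ∀ a ∈ ⨆ k, ρ.level (fun _ => ⊤) k, ∀ x ∈ ⨆ k, ρ.level I k,
      ∃ k, a ∈ ρ.level (fun _ => ⊤) k ∧ x ∈ ρ.level I k := by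
    intro a ha x hx
    obtain ⟨k, hk⟩ := hρ.exists_mem_level (I := fun _ => ⊤) (fun _ _ _ _ => trivial) ha
    obtain ⟨l, hl⟩ := hρ.exists_mem_level (pullback_mem_vanishingSubmodule hF) hx
    exact ⟨max k l, hmT (le_max_left k l) hk, hmI (le_max_right k l) hl⟩
  refine ⟨?_, Submodule.isClosed_topologicalClosure _, fun b hb x hx => ?_, fun b hb x hx => ?_,
    fun x hx => ?_⟩
  · rw [coreAlg_eq]
    refine Submodule.topologicalClosure_mono (iSup_mono fun k => Submodule.span_mono ?_)
    rintro _ ⟨u, v, f, hu, hv, -, rfl⟩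
    exact ⟨u, v, f, hu, hv, trivial, rfl⟩
  · rw [coreAlg_eq] at hb
    refine map_mem_closure₂ continuous_mul hb hx fun a ha y hy => ?_
    obtain ⟨k, hak, hyk⟩ := hlev a ha y hy
    refine Submodule.mem_iSup_of_mem k (hρ.mul_mem_level (I'' := I) (fun f _ g hg => ?_) hak hyk)
    intro z hz
    rw [ZeroAtInftyContinuousMap.mul_apply, hg z hz, mul_zero]
  · rw [coreAlg_eq] at hb
    refine map_mem_closure₂ continuous_mul hx hb fun y hy a ha => ?_
    obtain ⟨k, hak, hyk⟩ := hlev a ha y hy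
    refine Submodule.mem_iSup_of_mem k (hρ.mul_mem_level (I'' := I) (fun g hg f _ => ?_) hyk hak)
    intro z hz
    rw [ZeroAtInftyContinuousMap.mul_apply, hg z hz, zero_mul]
  · refine map_mem_closure ρ.continuous_endo hx fun y hy => ?_
    obtain ⟨k, hk⟩ := hρ.exists_mem_level (pullback_mem_vanishingSubmodule hF) hy
    refine Submodule.mem_iSup_of_mem (k + 1) ?_
    clear hy hx
    induction hk using Submodule.span_induction with
    | mem b hb =>
      obtain ⟨u, v, f, hu, hv, hf, rfl⟩ := hb
      rw [endo_unit]
      refine Submodule.smul_mem _ _ (Submodule.sum_mem _ fun i _ => Submodule.sum_mem _ fun j _ =>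
        unit_mem_level (by simp [hu]) (by simp [hv]) ?_)
      rintro _ ⟨z, hz, rfl⟩
      exact hf _ ⟨S.shift z, hF' z hz, rfl⟩
    | zero =>
      have := ρ.endo_smul 0 0
      rw [zero_smul, zero_smul] at this
      rw [this]
      exact zero_mem _
    | add x y _ _ hx hy =>
      rw [endo_add]
      exact add_mem hx hy
    | smul c x _ hx =>
      rw [endo_smul]
      exact Submodule.smul_mem _ c hx

/-- If g(x) ≠ 0 with x ∈ F, compress g minus an approximant at level k by t_u e t_u^*, with u the
initial word of x. The approximant's (u, u) entry vanishes at τ^k(x), so a function with value g(x)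
at x remains, too large for the approximation. -/
theorem IsCuntz.interFun_idealOf [LocallyCompactSpace X] {F : Set S.Tail} (hF : S.IsRobust F) :
    ρ.interFun (ρ.idealOf F) = vanishingIdeal F := by
  refine Set.Subset.antisymm (fun g hg x hx => ?_) fun g hg => ?_
  · by_contra hne
    have hpos : 0 < ‖g x‖ := norm_pos_iff.2 hne
    obtain ⟨b, hb, hbg⟩ := Metric.mem_closure_iff.1 hg _ hpos
    obtain ⟨k, hk⟩ := hρ.exists_mem_level (pullback_mem_vanishingSubmodule hF) hb
    obtain ⟨f, hf, rfl⟩ := ρ.exists_eq_sum_of_mem_level hk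
    set y := S.shift^[k] x with hy
    have hxy : S.cover.wordMap (S.initialWord k x) y = x := S.wordMap_initialWord k x
    let u : words n k := ⟨S.initialWord k x, mem_words.2 (S.length_initialWord k x)⟩
    obtain ⟨e, he1, -, hen⟩ := exists_c0_apply_eq_one (t := ∅) isClosed_empty (y := y) (by simp)
    have hen' : ‖e‖ ≤ 1 := (c0_norm_le e zero_le_one).2 hen
    set c := e * S.cover.pull u g * e - e * f u u * e with hc
    have h1 : ρ.unit u e u * (ρ.π g - ∑ s : words n k, ∑ t : words n k, ρ.unit s (f s t) t) *
        ρ.unit u e u = ρ.π (S.pushWord u c) := by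
      rw [mul_sub, sub_mul, hρ.unit_mul_π_mul_unit rfl, if_pos rfl, hρ.unit_mul_sum_mul_unit,
        ← unit_sub, hρ.unit_self_eq_π_pushWord]
    have h2 : S.pushWord u c x = g x := by
      have h3 := S.pushWord_apply_wordMap u c y
      rw [show S.cover.wordMap u y = x from hxy] at h3
      rw [h3, hc]
      have h4 : f u u y = 0 := hf u u y ⟨x, hx, rfl⟩
      have h5 : S.cover.pull u g y = g x := by
        rw [MultiSystem.pull_apply, show S.cover.wordMap u y = x from hxy]
      simp [he1, h4, h5]
    have h3 : ‖g x‖ ≤ ‖ρ.π g - ∑ s : words n k, ∑ t : words n k, ρ.unit s (f s t) t‖ := by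
      rw [← h2]
      refine (c0_norm_apply_le _ x).trans ((hρ.norm_le_norm_π _).trans ?_)
      rw [← h1]
      have hu := (ρ.norm_unit_le u u e).trans hen'
      calc _ ≤ ‖ρ.unit u e u‖ *
            ‖ρ.π g - ∑ s : words n k, ∑ t : words n k, ρ.unit s (f s t) t‖ * ‖ρ.unit u e u‖ :=
            norm_mul₃_le
        _ ≤ 1 * ‖ρ.π g - ∑ s : words n k, ∑ t : words n k, ρ.unit s (f s t) t‖ * 1 := by gcongr
        _ = _ := by ring
    rw [dist_eq_norm] at hbg
    exact absurd hbg (not_lt.2 h3)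
  · change ρ.π g ∈ ρ.idealOf F
    refine Submodule.le_topologicalClosure _ (Submodule.mem_iSup_of_mem 0 ?_)
    rw [← unit_nil]
    refine unit_mem_level rfl rfl ?_
    rintro _ ⟨x, hx, rfl⟩
    exact hg x hx

end IdealOf

end RowRep

end

noncomputable section

namespace RowRep

variable {n : ℕ} {X : Type u} [TopologicalSpace X] [T2Space X] {S : MultiSystem n X}
  {H : Type u} [NormedAddCommGroup H] [InnerProductSpace ℂ H] [CompleteSpace H]

/-! ### From ideals to closed sets -/

/-- The set of common zeros of the functions in `J`. -/
def zeroSet (ρ : RowRep S.cover H) (J : Submodule ℂ (H →L[ℂ] H)) : Set S.Tail :=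
  {y | ∀ f, ρ.π f ∈ J → f y = 0}

theorem isClosed_zeroSet (ρ : RowRep S.cover H) (J : Submodule ℂ (H →L[ℂ] H)) :
    IsClosed (ρ.zeroSet J) := by
  simp only [zeroSet, Set.ofPred_forall]
  exact isClosed_iInter fun f => isClosed_iInter fun _ =>
    isClosed_eq (map_continuous f) continuous_const

variable {ρ : RowRep S.cover H} {J : Submodule ℂ (H →L[ℂ] H)} (hJ : ρ.IsInvariantIdeal J)
include hJ

theorem IsInvariantIdeal.interFun_eq : ρ.interFun J = vanishingIdeal (ρ.zeroSet J) := by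
  have hc : Continuous ρ.π :=
    AddMonoidHomClass.continuous_of_bound ρ.π 1 fun f => by simpa using ρ.norm_π_le f
  have h := closed_ideal_eq_vanishingIdeal (J.comap (ρ.π : C₀(S.Tail, ℂ) →ₗ[ℂ] (H →L[ℂ] H)))
    (fun g f hf => by
      rw [Submodule.mem_comap] at hf ⊢
      have := hJ.mul_mem_left _ (ρ.π_mem_coreAlg g) _ hf
      exact (map_mul ρ.π g f).symm ▸ this)
    (hJ.isClosed.preimage hc)
  exact h

variable [LocallyCompactSpace X] (hρ : ρ.IsCuntz)

/-- The restriction of the quotient norm modulo `J` to `C₀(X̃)` dominates the values on the zero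
set of `J`. -/
theorem IsInvariantIdeal.norm_apply_le_norm_sub {x : S.Tail} (hx : x ∈ ρ.zeroSet J)
    (c : C₀(S.Tail, ℂ)) {j : H →L[ℂ] H} (hj : j ∈ J) : ‖c x‖ ≤ ‖ρ.π c - j‖ := by
  by_contra! hlt
  set l := c x with hl
  -- Half the gap: c may vary by η on the support of e and η + ‖c - j‖ is still below |l|.
  set η := (‖l‖ - ‖ρ.π c - j‖) / 2 with hη
  have hη0 : 0 < η := by
    rw [hη]
    linarith
  have hl0 : l ≠ 0 := norm_pos_iff.1 ((norm_nonneg _).trans_lt hlt)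
  have hcl : IsClosed {z | η ≤ ‖c z - l‖} :=
    isClosed_le continuous_const ((map_continuous c).sub continuous_const).norm
  have hxt : x ∉ {z | η ≤ ‖c z - l‖} := by
    change ¬ η ≤ ‖c x - l‖
    rw [← hl, sub_self, norm_zero]
    exact not_le.2 hη0
  obtain ⟨K, hK, hxK, hKt⟩ := exists_compact_subset hcl.isOpen_compl hxt
  obtain ⟨e, he1, he0, hen, -⟩ := exists_c0_bump hK hcl
    (Set.disjoint_left.2 fun z hz hz' => hKt hz hz')
  obtain ⟨d, hd1, hd0, -⟩ := exists_c0_apply_eq_one isOpen_interior.isClosed_compl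
    (y := x) (t := (interior K)ᶜ) (by simpa using hxK)
  have hde : d * e = d := by
    ext z
    by_cases hz : z ∈ interior K
    · simp [he1 z (interior_subset hz)]
    · simp [hd0 z hz]
  have hen' : ‖e‖ ≤ 1 := (c0_norm_le e zero_le_one).2 hen
  -- Modulo J, s equals e, yet ‖s‖ < 1 because l s is close to (c - j) e. As d e = d, the element d
  -- is congruent to d s^m for every m, and d s^m → 0 forces d ∈ J although d(x) = 1.
  set s : H →L[ℂ] H := ρ.π e - l⁻¹ • (j * ρ.π e) with hs
  have hjJ : l⁻¹ • (j * ρ.π e) ∈ J :=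
    J.smul_mem _ (hJ.mul_mem_right _ (ρ.π_mem_coreAlg e) _ hj)
  have hscore : s ∈ ρ.coreAlg := sub_mem (ρ.π_mem_coreAlg e) (hJ.le hjJ)
  have hs1 : ‖s‖ < 1 := by
    have h1 : l • s = ρ.π (l • e - c * e) + (ρ.π c - j) * ρ.π e := by
      rw [hs, smul_sub, smul_smul, mul_inv_cancel₀ hl0, one_smul, map_sub, map_smul, map_mul,
        sub_mul]
      abel
    have h2 : ‖l • e - c * e‖ ≤ η := by
      refine (c0_norm_le _ hη0.le).2 fun z => ?_
      have : (l • e - c * e) z = -((c z - l) * e z) := by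
        simp
        ring
      rw [this, norm_neg, norm_mul]
      by_cases hz : η ≤ ‖c z - l‖
      · rw [he0 z hz, norm_zero, mul_zero]
        exact hη0.le
      · calc _ ≤ η * 1 := by
              gcongr
              · exact (not_le.1 hz).le
              · exact hen z
          _ = η := mul_one η
    have h3 : ‖l • s‖ < ‖l‖ := by
      rw [h1]
      calc _ ≤ ‖ρ.π (l • e - c * e)‖ + ‖(ρ.π c - j) * ρ.π e‖ := norm_add_le _ _
        _ ≤ η + ‖ρ.π c - j‖ * 1 := by
          refine add_le_add ((ρ.norm_π_le _).trans h2) ((norm_mul_le _ _).trans ?_)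
          gcongr
          exact (ρ.norm_π_le e).trans hen'
        _ < ‖l‖ := by
          rw [hη]
          linarith
    rw [norm_smul] at h3
    exact (mul_lt_iff_lt_one_right (norm_pos_iff.2 hl0)).1 h3
  have hstep : ρ.π d - ρ.π d * s ∈ J := by
    have : ρ.π d - ρ.π d * s = ρ.π d * (l⁻¹ • (j * ρ.π e)) := by
      rw [hs, mul_sub, ← map_mul, hde, sub_sub_cancel]
    rw [this]
    exact hJ.mul_mem_left _ (ρ.π_mem_coreAlg d) _ hjJ
  have hpow : ∀ m : ℕ, ρ.π d - ρ.π d * s ^ m ∈ J := by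
    intro m
    induction m with
    | zero => simp
    | succ m ih =>
      have : ρ.π d - ρ.π d * s ^ (m + 1) =
          (ρ.π d - ρ.π d * s) + (ρ.π d - ρ.π d * s ^ m) * s := by
        rw [pow_succ, sub_mul, mul_assoc]
        abel
      rw [this]
      exact add_mem hstep (hJ.mul_mem_right _ hscore _ ih)
  have hlim : Filter.Tendsto (fun m : ℕ => ρ.π d - ρ.π d * s ^ m) Filter.atTop
      (nhds (ρ.π d)) := by
    have := ((tendsto_pow_atTop_nhds_zero_of_norm_lt_one hs1).const_mul (ρ.π d)).const_sub (ρ.π d)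
    simpa using this
  have hdJ : ρ.π d ∈ J := hJ.isClosed.mem_of_tendsto hlim (Filter.Eventually.of_forall hpow)
  exact one_ne_zero (hd1.symm.trans (hx d hdJ))

include hρ

/-- With y = τ^{|w|}(x) and x = σ̃_u(y), the element t_u e t_w^* f t_w e t_u^* of J is a function
whose value at x is f(σ̃_w(y)). -/
theorem IsInvariantIdeal.isRobust_zeroSet : S.IsRobust (ρ.zeroSet J) := by
  intro x hx w f hf
  set y := S.shift^[w.length] x with hy
  set u := S.initialWord w.length x with hu
  have hul : w.length = u.length := (S.length_initialWord _ _).symm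
  obtain ⟨e, he1, -, -⟩ := exists_c0_apply_eq_one (t := ∅) isClosed_empty (y := y) (by simp)
  have h1 : ρ.π (S.pushWord u (e * S.cover.pull w f * e)) ∈ J := by
    rw [← hρ.unit_self_eq_π_pushWord]
    have h2 := hρ.unit_mul_π_mul_unit (u := u) (p := w) (q := w) (v := u) rfl e f e
    rw [if_pos rfl] at h2
    rw [← h2]
    exact hJ.mul_mem_right _ (ρ.unit_mem_coreAlg hul e) _
      (hJ.mul_mem_left _ (ρ.unit_mem_coreAlg hul.symm e) _ hf)
  have h2 := hx _ h1
  have h3 := S.pushWord_apply_wordMap u (e * S.cover.pull w f * e) y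
  rw [show S.cover.wordMap u y = x from S.wordMap_initialWord w.length x, h2] at h3
  have h4 : (e * S.cover.pull w f * e) y = f (S.cover.wordMap w y) := by
    simp [he1, MultiSystem.pull_apply]
  exact (h3.trans h4).symm

/-- Compressing α(f) to the (i, i) corner, i the first letter of x, leaves a function with value
f(τ(x)) / n at x. -/
theorem IsInvariantIdeal.isShiftInvariant_zeroSet : S.IsShiftInvariant (ρ.zeroSet J) := by
  intro x hx f hf
  set i := x.1.1 0 with hi
  have hn : (n : ℂ) ≠ 0 := Nat.cast_ne_zero.2 fun h => (h ▸ i : Fin 0).elim0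
  obtain ⟨e, he1, -, -⟩ :=
    exists_c0_apply_eq_one (t := ∅) isClosed_empty (y := S.shift x) (by simp)
  have h1 : ρ.unit [i] e [i] * ρ.endo (ρ.π f) * ρ.unit [i] e [i] =
      (n : ℂ)⁻¹ • ρ.π (S.pushWord [i] (e * f * e)) := by
    rw [← unit_nil, endo_unit, mul_smul_comm, smul_mul_assoc, Finset.mul_sum, Finset.sum_mul,
      Finset.sum_eq_single i, Finset.mul_sum, Finset.sum_mul, Finset.sum_eq_single i]
    · rw [hρ.unit_mul_unit rfl, if_pos rfl, hρ.unit_mul_unit rfl, if_pos rfl,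
        hρ.unit_self_eq_π_pushWord]
    · intro j _ hj
      rw [hρ.unit_mul_unit rfl, if_pos rfl, hρ.unit_mul_unit (v := [j]) (u' := [i]) rfl,
        if_neg (by simpa using hj)]
    · simp
    · intro j _ hj
      rw [Finset.mul_sum, Finset.sum_mul]
      refine Finset.sum_eq_zero fun j' _ => ?_
      rw [hρ.unit_mul_unit (v := [i]) (u' := [j]) rfl, if_neg (by simpa using hj.symm), zero_mul]
    · simp
  have h2 : ρ.π (S.pushWord [i] (e * f * e)) ∈ J := by
    have h3 := hJ.mul_mem_right _ (ρ.unit_mem_coreAlg (u := [i]) (v := [i]) rfl e) _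
      (hJ.mul_mem_left _ (ρ.unit_mem_coreAlg (u := [i]) (v := [i]) rfl e) _ (hJ.endo_mem _ hf))
    rw [h1] at h3
    exact (J.smul_mem_iff (inv_ne_zero hn)).1 h3
  have h3 := hx _ h2
  rw [MultiSystem.pushWord, MultiSystem.pushWord, MultiSystem.push_apply, if_pos rfl] at h3
  simpa [he1] using h3

/-- The function t_u f t_u^* vanishes on the zero set, so it lies in J; multiplying by t_u e t_v^*
with f e close to f reaches the off-diagonal units. -/
theorem IsInvariantIdeal.idealOf_zeroSet_le : ρ.idealOf (ρ.zeroSet J) ≤ J := by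
  refine Submodule.topologicalClosure_minimal _ (iSup_le fun k => Submodule.span_le.2 ?_)
    hJ.isClosed
  rintro _ ⟨u, v, f, hu, hv, hf, rfl⟩
  have huJ : ρ.unit u f u ∈ J := by
    rw [hρ.unit_self_eq_π_pushWord]
    have : S.pushWord u f ∈ ρ.interFun J := by
      rw [hJ.interFun_eq]
      intro x hx
      rcases S.pushWord_apply_eq_or u f x with h | h
      · rw [h, hu]
        exact hf _ ⟨x, hx, rfl⟩
      · exact h
    exact this
  change ρ.unit u f v ∈ (J : Set (H →L[ℂ] H))
  rw [← hJ.isClosed.closure_eq]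
  refine Metric.mem_closure_iff.2 fun ε hε => ?_
  obtain ⟨e, he⟩ := exists_c0_approx_unit f (half_pos hε)
  refine ⟨ρ.unit u (f * e) v, ?_, ?_⟩
  · have h := hρ.unit_mul_unit (u := u) (v := u) (u' := u) (v' := v) rfl f e
    rw [if_pos rfl] at h
    rw [← h]
    exact hJ.mul_mem_right _ (ρ.unit_mem_coreAlg (hu.trans hv.symm) e) _ huJ
  · rw [dist_eq_norm, ← unit_sub]
    exact ((ρ.norm_unit_le _ _ _).trans he).trans_lt (half_lt_self hε)

open scoped Matrix.Norms.L2Operator in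
-- A coefficient of the matrix at y is the value at x = σ̃_u(y) of the function A b B, where A and B
-- are a row and a column of matrix units of norms at most ‖ξ‖ and ‖η‖. As A j B ∈ J, the scalar
-- estimate at x ∈ `zeroSet J` applies.
theorem IsInvariantIdeal.norm_matrix_le {k : ℕ} (f : words n k → words n k → C₀(S.Tail, ℂ))
    {j : H →L[ℂ] H} (hj : j ∈ J) {y : S.Tail} (hy : y ∈ S.shift^[k] '' ρ.zeroSet J) :
    ‖(Matrix.of fun u v => f u v y : Matrix (words n k) (words n k) ℂ)‖ ≤
      ‖∑ u : words n k, ∑ v : words n k, ρ.unit u (f u v) v - j‖ := by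
  set b := ∑ u : words n k, ∑ v : words n k, ρ.unit u (f u v) v with hb
  obtain ⟨x, hx, hxy⟩ := hy
  set u := S.initialWord k x with hu
  have hul : u.length = k := S.length_initialWord k x
  have hux : S.cover.wordMap u y = x := by rw [← hxy]; exact S.wordMap_initialWord k x
  refine matrix_norm_le_of_sum_le _ (norm_nonneg _) fun η ξ => ?_
  obtain ⟨e, he1, -, hen⟩ := exists_c0_apply_eq_one (t := ∅) isClosed_empty (y := y) (by simp)
  have hen' : ‖e‖ ≤ 1 := (c0_norm_le e zero_le_one).2 hen
  set A : H →L[ℂ] H := ∑ p : words n k, star (ξ p) • ρ.unit u e p with hA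
  set B : H →L[ℂ] H := ∑ q : words n k, η q • ρ.unit q e u with hB
  have hAn : ‖A‖ ≤ √(∑ p, ‖ξ p‖ ^ 2) := ρ.norm_row_le k u e hen' ξ
  have hBn : ‖B‖ ≤ √(∑ p, ‖η p‖ ^ 2) := by
    rw [← norm_star]
    have h := ρ.norm_row_le k u (star e) ((c0_norm_le _ zero_le_one).2 fun z => by
      rw [ZeroAtInftyContinuousMap.star_apply, norm_star]; exact hen z) η
    have hBs : star B = ∑ q : words n k, star (η q) • ρ.unit u (star e) q := by
      simp only [hB, star_sum, star_smul, star_unit]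
    rwa [hBs]
  have hAc : A ∈ ρ.coreAlg := Submodule.sum_mem _ fun p _ => Submodule.smul_mem _ _
    (ρ.unit_mem_coreAlg (hul.trans (mem_words.1 p.2).symm) e)
  have hBc : B ∈ ρ.coreAlg := Submodule.sum_mem _ fun p _ => Submodule.smul_mem _ _
    (ρ.unit_mem_coreAlg ((mem_words.1 p.2).trans hul.symm) e)
  set g : C₀(S.Tail, ℂ) :=
    ∑ p, ∑ q, star (ξ p) • η q • (e * f p q * e) with hg
  have hAB : A * b * B = ρ.π (S.pushWord u g) := by
    rw [← hρ.unit_self_eq_π_pushWord, hg, unit_sum, hA, Finset.sum_mul, Finset.sum_mul]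
    refine Finset.sum_congr rfl fun p _ => ?_
    rw [unit_sum, hB, Finset.mul_sum]
    refine Finset.sum_congr rfl fun q _ => ?_
    rw [unit_smul, unit_smul, ← hρ.unit_mul_sum_mul_unit f u u p q e e, ← hb]
    simp only [smul_mul_assoc, mul_smul_comm, smul_comm (η q)]
  have hgy : g y = ∑ p, ∑ q, star (ξ p) * (f p q y * η q) := by
    rw [hg, c0_sum_apply]
    refine Finset.sum_congr rfl fun p _ => ?_
    rw [c0_sum_apply]
    refine Finset.sum_congr rfl fun q _ => ?_
    simp [he1, mul_comm (η q)]
  have hval : S.pushWord u g x = g y := by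
    rw [← hux]
    exact S.pushWord_apply_wordMap u g y
  have hAJ : A * j * B ∈ J := hJ.mul_mem_right _ hBc _ (hJ.mul_mem_left _ hAc _ hj)
  have hmain := hJ.norm_apply_le_norm_sub hx (S.pushWord u g) hAJ
  simp only [Matrix.of_apply]
  rw [← hgy, ← hval]
  refine hmain.trans ?_
  rw [← hAB, ← sub_mul, ← mul_sub]
  calc _ ≤ ‖A‖ * ‖b - j‖ * ‖B‖ := norm_mul₃_le
    _ ≤ √(∑ p, ‖ξ p‖ ^ 2) * ‖b - j‖ * √(∑ p, ‖η p‖ ^ 2) := by gcongr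
    _ = _ := by ring

open scoped Matrix.Norms.L2Operator in
-- Multiplying all entries of an approximant by one scalar cutoff kills them on τ^k(`zeroSet J`),
-- where the matrix is already small in norm.
theorem IsInvariantIdeal.le_idealOf_zeroSet : J ≤ ρ.idealOf (ρ.zeroSet J) := by
  intro j hj
  refine Metric.mem_closure_iff.2 fun δ hδ => ?_
  set ε := δ / 4 with hε
  have hε0 : 0 < ε := by positivity
  have hjc := hJ.le hj
  rw [coreAlg_eq] at hjc
  obtain ⟨b, hb, hbj⟩ := Metric.mem_closure_iff.1 hjc ε hε0
  obtain ⟨k, hk⟩ := hρ.exists_mem_level (I := fun _ => ⊤) (fun _ _ _ _ => trivial) hb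
  obtain ⟨f, -, rfl⟩ := ρ.exists_eq_sum_of_mem_level hk
  rw [dist_comm, dist_eq_norm] at hbj
  set N : S.Tail → ℝ := fun y =>
    ‖(Matrix.of fun u v => f u v y : Matrix (words n k) (words n k) ℂ)‖ with hN
  have hNc : Continuous N :=
    continuous_norm.comp (continuous_matrix fun u v => map_continuous (f u v))
  -- Zero where N ≤ ε, which includes τ^k(`zeroSet J`), and 1 where N ≥ 2ε, so the cutoff costs at
  -- most 2ε.
  set φ : S.Tail → ℝ := fun y => min 1 (max 0 (N y / ε - 1)) with hφ
  have hφc : Continuous φ := by fun_prop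
  have hφ0 : ∀ y, 0 ≤ φ y := fun y => le_min zero_le_one (le_max_left _ _)
  have hφ1 : ∀ y, φ y ≤ 1 := fun y => min_le_left _ _
  have hφN : ∀ y, (1 - φ y) * N y ≤ 2 * ε := by
    intro y
    by_cases hy : N y ≤ 2 * ε
    · refine le_trans (mul_le_of_le_one_left (norm_nonneg _) ?_) hy
      linarith [hφ0 y]
    · have h1 : 1 ≤ N y / ε - 1 := by
        rw [le_sub_iff_add_le, le_div_iff₀ hε0]
        linarith [not_le.1 hy]
      have : φ y = 1 := min_eq_left (h1.trans (le_max_right _ _))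
      rw [this, sub_self, zero_mul]
      positivity
  let g : words n k → words n k → C₀(S.Tail, ℂ) := fun u v =>
    c0MulBounded (f u v) (fun y => (φ y : ℂ)) (Complex.continuous_ofReal.comp hφc) 1 fun y => by
      rw [Complex.norm_real, Real.norm_of_nonneg (hφ0 y)]
      exact hφ1 y
  have hgI : ∀ u v, g u v ∈ vanishingSubmodule (S.shift^[k] '' ρ.zeroSet J) := by
    intro u v y hy
    have h1 : N y ≤ ε := (hJ.norm_matrix_le hρ f hj hy).trans hbj.le
    have h2 : φ y = 0 := by
      have : N y / ε - 1 ≤ 0 := by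
        rw [sub_nonpos, div_le_one hε0]
        exact h1
      simp only [hφ]
      rw [max_eq_left this, min_eq_right zero_le_one]
    change f u v y * (φ y : ℂ) = 0
    rw [h2, Complex.ofReal_zero, mul_zero]
  refine ⟨∑ u : words n k, ∑ v : words n k, ρ.unit u (g u v) v,
    Submodule.mem_iSup_of_mem k (Submodule.sum_mem _ fun u _ => Submodule.sum_mem _ fun v _ =>
      unit_mem_level (mem_words.1 u.2) (mem_words.1 v.2) (hgI u v)), ?_⟩
  have hdiff : ‖∑ u : words n k, ∑ v : words n k, ρ.unit u (f u v) v -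
      ∑ u : words n k, ∑ v : words n k, ρ.unit u (g u v) v‖ ≤ 2 * ε := by
    simp only [← Finset.sum_sub_distrib, ← unit_sub]
    refine ρ.norm_sum_unit_le k (fun u v => f u v - g u v) (by positivity) fun y => ?_
    have h1 : (Matrix.of fun u v => (f u v - g u v) y : Matrix (words n k) (words n k) ℂ) =
        ((1 - φ y : ℝ) : ℂ) • Matrix.of fun u v => f u v y := by
      ext u v
      have : g u v y = f u v y * (φ y : ℂ) := rfl
      simp [this]
      ring
    rw [h1, norm_smul, Complex.norm_real, Real.norm_of_nonneg (sub_nonneg.2 (hφ1 y))]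
    exact hφN y
  rw [dist_eq_norm]
  calc _ ≤ ‖j - ∑ u : words n k, ∑ v : words n k, ρ.unit u (f u v) v‖ +
        ‖∑ u : words n k, ∑ v : words n k, ρ.unit u (f u v) v -
          ∑ u : words n k, ∑ v : words n k, ρ.unit u (g u v) v‖ :=
        norm_sub_le_norm_sub_add_norm_sub _ _ _
    _ < ε + (2 * ε + ε) := by
      refine add_lt_add_of_lt_of_le ?_ (hdiff.trans (by linarith))
      rwa [norm_sub_rev]
    _ = δ := by
      rw [hε]
      ring

theorem IsInvariantIdeal.idealOf_zeroSet : ρ.idealOf (ρ.zeroSet J) = J :=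
  (hJ.idealOf_zeroSet_le hρ).antisymm (hJ.le_idealOf_zeroSet hρ)

end RowRep

end

/-! ### The bijective correspondence -/

theorem lemmaL {n : ℕ} {X : Type u} [TopologicalSpace X] [T2Space X] [LocallyCompactSpace X]
    (S : MultiSystem n X) (hS : S.IsSurjective)
    {H : Type u} [NormedAddCommGroup H] [InnerProductSpace ℂ H] [CompleteSpace H]
    (ρ : RowRep S.cover H) (hρ : ρ.IsCStarEnvelope) :
    ∃ Φ : {J : Submodule ℂ (H →L[ℂ] H) // ρ.IsInvariantIdeal J} →
        {F : Set S.Tail // IsClosed F ∧ S.IsRobust F ∧ S.IsShiftInvariant F},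
      Function.Bijective Φ ∧
      ∀ (J : {J : Submodule ℂ (H →L[ℂ] H) // ρ.IsInvariantIdeal J}) (F : Set S.Tail),
        IsClosed F → (ρ.interFun J.1 = vanishingIdeal F ↔ F = (Φ J).1) := by
  have hc := hρ.isCuntz
  refine ⟨fun J => ⟨ρ.zeroSet J.1, ρ.isClosed_zeroSet J.1, J.2.isRobust_zeroSet hc,
    J.2.isShiftInvariant_zeroSet hc⟩, ⟨fun J J' h => ?_, fun F => ?_⟩, fun J F hF => ?_⟩
  · apply Subtype.ext
    rw [← J.2.idealOf_zeroSet hc, ← J'.2.idealOf_zeroSet hc]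
    exact congrArg ρ.idealOf (congrArg Subtype.val h)
  · have hJ := hc.isInvariantIdeal_idealOf F.2.2.1 F.2.2.2
    refine ⟨⟨ρ.idealOf F.1, hJ⟩, Subtype.ext ?_⟩
    refine vanishingIdeal_injOn_isClosed (ρ.isClosed_zeroSet _) F.2.1 ?_
    rw [← hJ.interFun_eq, hc.interFun_idealOf F.2.2.1]
  · rw [J.2.interFun_eq]
    constructor
    · exact fun h => vanishingIdeal_injOn_isClosed hF (ρ.isClosed_zeroSet _) h.symm
    · rintro rfl
      rfl
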